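/- Let $\lambda_1,\lambda_2,\mu_1,\mu_2,c_1,c_2>0$ be real numbers with $\lambda_1>\mu_1c_1$ and $\lambda_1+\lambda_2>\mu_1c_1+\mu_2c_2$, and let $a\ge 0$ be an integer. Consider the continuous-time random walk on $\mathbb N^2$ which jumps from $(n_1,n_2)$ to $(n_1+1,n_2)$ at rate $\mu_1c_1$, to $(n_1,n_2+1)$ at rate $\mu_2c_2$, to $(n_1-1,n_2)$ at rate $\lambda_1$ if $n_1>0$, and to $(n_1,n_2-1)$ at rate $\lambda_2+\lambda_1\mathbf 1_{\{n_1=0,\,n_2>a\}}$ if $n_2>0$. Let $p$ be its stationary distribution, and set $$P(x,y)=\sum_{n_1,n_2\ge0}p(n_1,n_2)x^{n_1}y^{n_2},\qquad P_1(x)=\sum_{n\ge0}p(n,0)x^n,\qquad P_2^-(y)=\sum_{n=0}^{a}p(0,n)y^n.$$ Write $s=\lambda_1+\lambda_2+\mu_1c_1+\mu_2c_2$, $r_1=\sqrt{\lambda_1/(\mu_1c_1)}$, $D_{r_1}=\{x\in\mathbb C:|x|<r_1\}$, $$K(x,y)=\mu_1c_1x^2y+\mu_2c_2xy^2-sxy+\lambda_1y+\lambda_2x,\qquad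 \Delta_1(y)=(\mu_2c_2y^2-sy+\lambda_2)^2-4\mu_1c_1\lambda_1y^2 .$$ Then $\Delta_1$ has exactly four real zeros $y_1,y_2,y_3,y_4$, and they satisfy $0<y_1<y_2<1<y_3<y_4$. Put $$\Theta_1(y)=\arctan\left(\frac{\sqrt{-\Delta_1(y)}}{\mu_2c_2y^2-sy+2\lambda_1+\lambda_2}\right)\quad (y_1\le y\le y_2),$$ $$\Phi_1(y)=\frac1\pi\,\mathrm{p.v.}\!\int_{y_1}^{y_2}\frac{y(\lambda_2-\mu_2c_2\xi^2)\Theta_1(\xi)}{\xi(\mu_2c_2y\xi-\lambda_2)}\frac{d\xi}{\xi-y}\quad (y_1<y<y_2),$$ where the Cauchy principal value exists, and $$\phi_1(x)=\exp\left(\frac x\pi\int_{y_1}^{y_2}\frac{(\lambda_2-\mu_2c_2y^2)\Theta_1(y)}{yK(x,y)}\,dy\right)\quad(x\in D_{r_1}).$$ Then for every $x\in D_{r_1}$ the series defining $P_1(x)$ converges absolutely, the integrands in $\phi_1(x)$ and in the following formula are integrable on $[y_1,y_2]$, and $$P_1(x)=\phi_1(x)P(0,0)+\frac{x\lambda_1\phi_1(x)}{\lambda_2\pi}\int_{y_1}^{y_2}\frac{(\lambda_2-\mu_2c_2y^2)P_2^-(y)}{yK(x,y)}\sin(\Theta_1(y))\,e^{-\Phi_1(y)}\,dy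 .$$ -/

import Mathlib

open MeasureTheory Filter Topology Set

noncomputable section

namespace TrunkReservation

/-- The numerical data of the limiting random walk (no constraints are bundled):
arrival rates `lam₁`, `lam₂`, service rates `mu₁`, `mu₂`, rescaled capacities `c₁`, `c₂`,
and the trunk reservation threshold `a`. -/
structure Model where
  lam₁ : ℝ
  lam₂ : ℝ
  mu₁ : ℝ
  mu₂ : ℝ
  c₁ : ℝ
  c₂ : ℝ
  a : ℕ

/-- The states `(n₁, n₂)` of the walk: numbers of idle servers in the two data centers. -/
abbrev State := ℕ × ℕ

/-- `π` is a stationary distribution of the continuous-time Markov chain with jump rates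
`q n m` from `n` to `m ≠ n`: it is a probability distribution satisfying global balance
(in every state the flow out of the state equals the flow into it). For bounded rates, as below,
the chain does not explode and this is equivalent to invariance under the transition semigroup. -/
structure IsStationaryDistribution {S : Type*} (q : S → S → ℝ) (π : S → ℝ) : Prop where
  nonneg : ∀ n, 0 ≤ π n
  hasSum_one : HasSum π 1
  balance : ∀ m, HasSum (fun n => π n * q n m) (π m * ∑' k, q m k)

/-- `HasCauchyPV f α β c v`: the Cauchy principal value at `c` of `∫_α^β f` exists and is `v`. -/
def HasCauchyPV (f : ℝ → ℝ) (α β c v : ℝ) : Prop :=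
  (∀ᶠ ε in 𝓝[>] (0 : ℝ), IntervalIntegrable f volume α (c - ε) ∧
    IntervalIntegrable f volume (c + ε) β) ∧
  Tendsto (fun ε : ℝ => (∫ ξ in α..(c - ε), f ξ) + ∫ ξ in (c + ε)..β, f ξ) (𝓝[>] 0) (𝓝 v)

/-- The Cauchy principal value at `c` of `∫_α^β f` (meaningful when it exists). -/
def cauchyPV (f : ℝ → ℝ) (α β c : ℝ) : ℝ :=
  limUnder (𝓝[>] (0 : ℝ)) fun ε : ℝ => (∫ ξ in α..(c - ε), f ξ) + ∫ ξ in (c + ε)..β, f ξ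

namespace Model

variable (M : Model)

/-- The jump rate of the random walk from the state `n` to the state `m`. -/
def rate (n m : State) : ℝ :=
  if m = (n.1 + 1, n.2) then M.mu₁ * M.c₁
  else if m = (n.1, n.2 + 1) then M.mu₂ * M.c₂
  else if n = (m.1 + 1, m.2) then M.lam₁
  else if n = (m.1, m.2 + 1) then M.lam₂ + (if n.1 = 0 ∧ M.a < n.2 then M.lam₁ else 0)
  else 0

/-- The total rate `λ₁ + λ₂ + μ₁ c₁ + μ₂ c₂`. -/
def total : ℝ := M.lam₁ + M.lam₂ + M.mu₁ * M.c₁ + M.mu₂ * M.c₂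

/-- The radius `r₁ = √(λ₁ / (μ₁ c₁))`. -/
def r₁ : ℝ := √(M.lam₁ / (M.mu₁ * M.c₁))

/-- The kernel `K(x, y)`. -/
def K (x y : ℂ) : ℂ :=
  (M.mu₁ * M.c₁ : ℝ) * x ^ 2 * y + (M.mu₂ * M.c₂ : ℝ) * x * y ^ 2 - (M.total : ℂ) * x * y
    + (M.lam₁ : ℂ) * y + (M.lam₂ : ℂ) * x

/-- The discriminant `Δ₁(y)` of the kernel as a polynomial in `x`. -/
def Delta₁ (y : ℝ) : ℝ :=
  (M.mu₂ * M.c₂ * y ^ 2 - M.total * y + M.lam₂) ^ 2 - 4 * (M.mu₁ * M.c₁) * M.lam₁ * y ^ 2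

/-- The angle `Θ₁(y)`. -/
def Theta₁ (y : ℝ) : ℝ :=
  Real.arctan (√(-M.Delta₁ y) /
    (M.mu₂ * M.c₂ * y ^ 2 - M.total * y + 2 * M.lam₁ + M.lam₂))

/-- The integrand of the integral in the exponent of `φ₁(x)`. -/
def phi₁Integrand (x : ℂ) (y : ℝ) : ℂ :=
  (((M.lam₂ - M.mu₂ * M.c₂ * y ^ 2) * M.Theta₁ y : ℝ) : ℂ) / (y * M.K x y)

/-- The function `φ₁(x)`, the branch points `y₁, y₂` being given. -/
def phi₁ (y₁ y₂ : ℝ) (x : ℂ) : ℂ :=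
  Complex.exp (x / (Real.pi : ℂ) * ∫ y in y₁..y₂, M.phi₁Integrand x y)

/-- The (singular at `ξ = y`) integrand of the principal value integral defining `Φ₁(y)`. -/
def Phi₁Integrand (y ξ : ℝ) : ℝ :=
  y * (M.lam₂ - M.mu₂ * M.c₂ * ξ ^ 2) * M.Theta₁ ξ /
    (ξ * (M.mu₂ * M.c₂ * y * ξ - M.lam₂)) / (ξ - y)

/-- The function `Φ₁(y)`, the branch points `y₁, y₂` being given. -/
def Phi₁ (y₁ y₂ y : ℝ) : ℝ :=
  1 / Real.pi * cauchyPV (M.Phi₁Integrand y) y₁ y₂ y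

end Model

/-- The generating function `P(x, y) = ∑ p(n₁, n₂) x^n₁ y^n₂`. -/
def genP (p : State → ℝ) (x y : ℂ) : ℂ := ∑' n : State, (p n : ℂ) * x ^ n.1 * y ^ n.2

/-- The boundary generating function `P₁(x) = ∑ p(n₁, 0) x^n₁`. -/
def genP₁ (p : State → ℝ) (x : ℂ) : ℂ := ∑' n : ℕ, (p (n, 0) : ℂ) * x ^ n

/-- The polynomial `P₂⁻(y) = ∑_{n₂ ≤ a} p(0, n₂) y^n₂`. -/
def polyP₂minus (a : ℕ) (p : State → ℝ) (y : ℝ) : ℝ :=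
  ∑ n ∈ Finset.range (a + 1), p (0, n) * y ^ n

/-- The integrand of the integral term in the formula for `P₁(x)`. -/
def Model.P₁Integrand (M : Model) (p : State → ℝ) (y₁ y₂ : ℝ) (x : ℂ) (y : ℝ) : ℂ :=
  (((M.lam₂ - M.mu₂ * M.c₂ * y ^ 2) * polyP₂minus M.a p y : ℝ) : ℂ) / (y * M.K x y) *
    ((Real.sin (M.Theta₁ y) * Real.exp (-M.Phi₁ y₁ y₂ y) : ℝ) : ℂ)

end TrunkReservation

end

open TrunkReservation

namespace TrunkReservation

open ComplexConjugate

/-! Dividing `K x y` by `x * y` separates the variables. With `rho = 2√(μ₁c₁λ₁)`, the point `x = r₁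
exp(iθ)` contributes `rho * cos θ`, so `K` vanishes there as soon as `μ₂c₂ y + λ₂ / y = s - rho *
cos θ`. The smaller solution `root θ` is real and lies in `(0, 1)`; as `θ` runs over `[0, π]` it
sweeps the cut `[y₁, y₂]` backwards. Everything on the cut is therefore transported to the upper
half of the circle `|x| = r₁`.

In stationarity the generator has mean zero on `x ^ n₁ * y ^ n₂` once this function has enough
moments, which a Lyapunov argument supplies (`Stable.summable_geometric`). On `K = 0` only the
boundary terms survive (`Stable.functional_equation`). Since `y = root θ` is real, so is the series
`∑ p(0, k) y ^ k`; eliminating it shows that `λ₂ P₁ + λ₁ P₂⁻` is a real multiple of `1 - y / x`,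
whose argument is `Θ₁` (`Stable.boundary_equation`). This is a Riemann-Hilbert problem for `P₁` on
the disc.

The homogeneous problem is solved by `exp S`, where `S = sineSeries angle` has imaginary part `Θ₁`
on the upper half circle; by a Plemelj formula its real part there is `Φ₁` (`sineSeries_exp_mul_I`,
`Stable.hasCauchyPV`), and inside the disc `exp S` is `φ₁`. The quotient `P₁ exp(-S)` has real
Taylor coefficients, is continuous up to the circle, and has the known imaginary part `(λ₁ / λ₂) P₂⁻
sin Θ₁ exp(-Φ₁)` on the open upper half circle. The Schwarz formula
`eq_add_integral_im_mul_schwarzKernel` recovers it from this and its value `P(0, 0)` at `0`; the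
substitution `y = root θ` turns the Schwarz kernel into the density with `K` in the denominator. -/

/-! ### The Schwarz formula on the unit disc -/

/-- The kernel of the Schwarz formula that recovers a real-coefficient holomorphic function on the
unit disc from its imaginary part on the upper half circle. -/
noncomputable def schwarzKernel (z : ℂ) (θ : ℝ) : ℂ :=
  2 * z * Real.sin θ / (1 - 2 * z * Real.cos θ + z ^ 2)

lemma exp_mul_I_mul_exp_neg_mul_I (θ : ℝ) :
    Complex.exp (θ * Complex.I) * Complex.exp (-(θ * Complex.I)) = 1 := by
  rw [← Complex.exp_add, add_neg_cancel, Complex.exp_zero]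

lemma two_cos_eq (θ : ℝ) : 2 * (Real.cos θ : ℂ) =
    Complex.exp (θ * Complex.I) + Complex.exp (-(θ * Complex.I)) := by
  rw [Complex.ofReal_cos, Complex.cos]; ring_nf

lemma two_sin_eq (θ : ℝ) : 2 * (Real.sin θ : ℂ) =
    -Complex.I * (Complex.exp (θ * Complex.I) - Complex.exp (-(θ * Complex.I))) := by
  rw [Complex.ofReal_sin, Complex.sin]; ring_nf

lemma schwarzKernel_denom_eq (z : ℂ) (θ : ℝ) : 1 - 2 * z * Real.cos θ + z ^ 2 =
    (1 - z * Complex.exp (θ * Complex.I)) * (1 - z * Complex.exp (-(θ * Complex.I))) := by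
  linear_combination (-z) * two_cos_eq θ - z ^ 2 * exp_mul_I_mul_exp_neg_mul_I θ

lemma norm_exp_neg_ofReal_mul_I (θ : ℝ) : ‖Complex.exp (-(θ * Complex.I))‖ = 1 := by
  have := Complex.norm_exp_ofReal_mul_I (-θ)
  rwa [Complex.ofReal_neg, neg_mul] at this

lemma one_sub_mul_ne_zero {z w : ℂ} (hz : ‖z‖ < 1) (hw : ‖w‖ = 1) : 1 - z * w ≠ 0 := by
  intro h
  have h2 : ‖z * w‖ = 1 := by rw [← sub_eq_zero.mp h, norm_one]
  rw [norm_mul, hw, mul_one] at h2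
  exact hz.ne h2

lemma schwarzKernel_denom_ne_zero {z : ℂ} (hz : ‖z‖ < 1) (θ : ℝ) :
    1 - 2 * z * Real.cos θ + z ^ 2 ≠ 0 := by
  rw [schwarzKernel_denom_eq]
  exact mul_ne_zero (one_sub_mul_ne_zero hz (Complex.norm_exp_ofReal_mul_I θ))
    (one_sub_mul_ne_zero hz (norm_exp_neg_ofReal_mul_I θ))

lemma schwarzKernel_eq {z : ℂ} (hz : ‖z‖ < 1) (θ : ℝ) : schwarzKernel z θ =
    -Complex.I * ((1 - z * Complex.exp (θ * Complex.I))⁻¹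
      - (1 - z * Complex.exp (-(θ * Complex.I)))⁻¹) := by
  have h1 := one_sub_mul_ne_zero hz (Complex.norm_exp_ofReal_mul_I θ)
  have h2 := one_sub_mul_ne_zero hz (norm_exp_neg_ofReal_mul_I θ)
  have h3 := two_sin_eq θ
  rw [schwarzKernel, schwarzKernel_denom_eq, div_eq_iff (mul_ne_zero h1 h2)]
  generalize Complex.exp (θ * Complex.I) = e at *
  generalize Complex.exp (-(θ * Complex.I)) = e' at *
  field_simp
  linear_combination z * h3

lemma continuous_schwarzKernel {z : ℂ} (hz : ‖z‖ < 1) : Continuous (schwarzKernel z) := by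
  unfold schwarzKernel
  exact Continuous.div (by fun_prop) (by fun_prop) (schwarzKernel_denom_ne_zero hz)

lemma schwarzKernel_two_pi_sub (z : ℂ) (θ : ℝ) :
    schwarzKernel z (2 * Real.pi - θ) = -schwarzKernel z θ := by
  simp only [schwarzKernel, Real.sin_two_pi_sub, Real.cos_two_pi_sub]
  push_cast; ring

/-- The Schwarz formula for real-coefficient functions, in terms of the imaginary part. -/
theorem eq_add_integral_im_mul_schwarzKernel {F : ℂ → ℂ}
    (hF : DiffContOnCl ℂ F (Metric.ball 0 1))
    (hconj : ∀ z, ‖z‖ = 1 → F (conj z) = conj (F z)) {z : ℂ} (hz : ‖z‖ < 1) :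
    F z = F 0 + 1 / (Real.pi : ℂ) * ∫ θ in (0 : ℝ)..Real.pi,
      ((F (Complex.exp (θ * Complex.I))).im : ℂ) * schwarzKernel z θ := by
  have hcont : ContinuousOn F (Metric.closedBall 0 1) := by
    have := hF.continuousOn
    rwa [closure_ball _ one_ne_zero] at this
  have hcirc : Continuous fun θ : ℝ => F (Complex.exp (θ * Complex.I)) := by
    refine hcont.comp_continuous (by fun_prop) fun θ => ?_
    simp [Complex.norm_exp_ofReal_mul_I]
  have hk := continuous_schwarzKernel hz
  have hG : DiffContOnCl ℂ (fun ζ => (1 - z * ζ)⁻¹ • F ζ) (Metric.ball 0 1) := by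
    refine DiffContOnCl.smul (DiffContOnCl.inv ?_ ?_) hF
    · exact (Differentiable.diffContOnCl (by fun_prop))
    · intro ζ hζ
      rw [closure_ball _ one_ne_zero, mem_closedBall_zero_iff] at hζ
      intro h
      have h2 : ‖z * ζ‖ = 1 := by rw [← sub_eq_zero.mp h, norm_one]
      rw [norm_mul] at h2
      nlinarith [norm_nonneg z, norm_nonneg ζ]
  -- The two simple fractions of the Schwarz kernel are two Cauchy integrals: `F` at `z`, and `F ζ /
  -- (1 - z ζ)` at `0`, the latter holomorphic because its pole lies outside the closed disc.
  have c1 := hF.circleIntegral_sub_inv_smul (w := z) (by simpa using hz)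
  have c2 := hG.circleIntegral_sub_inv_smul (w := 0) (by simp)
  have key : ∫ θ in (0 : ℝ)..2 * Real.pi, F (Complex.exp (θ * Complex.I)) * schwarzKernel z θ
      = (∮ ζ in C(0, 1), (ζ - z)⁻¹ • F ζ) -
        ∮ ζ in C(0, 1), (ζ - 0)⁻¹ • ((1 - z * ζ)⁻¹ • F ζ) := by
    rw [← circleIntegral.integral_sub, circleIntegral]
    · refine intervalIntegral.integral_congr fun θ _ => ?_
      have h1 := one_sub_mul_ne_zero hz (Complex.norm_exp_ofReal_mul_I θ)
      have h2 := one_sub_mul_ne_zero hz (norm_exp_neg_ofReal_mul_I θ)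
      have h3 : Complex.exp (θ * Complex.I) ≠ 0 := Complex.exp_ne_zero _
      have h5 : Complex.exp (-(θ * Complex.I)) = (Complex.exp (θ * Complex.I))⁻¹ :=
        Complex.exp_neg _
      have h4 : Complex.exp (θ * Complex.I) - z ≠ 0 := by
        intro h
        apply h2
        rw [h5, ← sub_eq_zero.mp h, mul_inv_cancel₀ h3, sub_self]
      simp only [schwarzKernel_eq hz, deriv_circleMap, circleMap, Complex.ofReal_one, one_mul,
        zero_add, smul_eq_mul, sub_zero]
      have h6 : (1 - z * Complex.exp (-(θ * Complex.I)))⁻¹ =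
          Complex.exp (θ * Complex.I) * (Complex.exp (θ * Complex.I) - z)⁻¹ := by
        rw [h5] at h2 ⊢
        field_simp
      rw [h6]
      field_simp
      ring
    · refine ContinuousOn.circleIntegrable zero_le_one ?_
      refine ContinuousOn.smul (ContinuousOn.inv₀ (continuous_sub_right _).continuousOn ?_)
        (hcont.mono Metric.sphere_subset_closedBall)
      rintro ζ hζ h
      rw [mem_sphere_zero_iff_norm, sub_eq_zero.mp h] at hζ
      exact hz.ne hζ
    · refine ContinuousOn.circleIntegrable zero_le_one ?_
      have := hG.continuousOn
      rw [closure_ball _ one_ne_zero] at this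
      refine ContinuousOn.smul (ContinuousOn.inv₀ (continuous_sub_right _).continuousOn ?_)
        (this.mono Metric.sphere_subset_closedBall)
      rintro ζ hζ h
      rw [mem_sphere_zero_iff_norm, sub_eq_zero.mp h] at hζ
      simp at hζ
  -- The reflection `θ ↦ 2π - θ` negates the kernel and conjugates `F`, so the lower half circle
  -- combines with the upper one into `F - conj F = 2i Im F`.
  have half : ∫ θ in (0 : ℝ)..2 * Real.pi, F (Complex.exp (θ * Complex.I)) * schwarzKernel z θ
      = 2 * Complex.I * ∫ θ in (0 : ℝ)..Real.pi,
        ((F (Complex.exp (θ * Complex.I))).im : ℂ) * schwarzKernel z θ := by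
    have hint : ∀ a b : ℝ, IntervalIntegrable
        (fun θ : ℝ => F (Complex.exp (θ * Complex.I)) * schwarzKernel z θ) volume a b :=
      fun a b => (hcirc.mul hk).intervalIntegrable a b
    rw [← intervalIntegral.integral_add_adjacent_intervals (hint 0 Real.pi) (hint _ _)]
    have := intervalIntegral.integral_comp_sub_left (a := 0) (b := Real.pi)
      (fun θ : ℝ => F (Complex.exp (θ * Complex.I)) * schwarzKernel z θ) (2 * Real.pi)
    rw [show 2 * Real.pi - Real.pi = Real.pi by ring, sub_zero] at this
    rw [← this, ← intervalIntegral.integral_add (hint _ _), ← intervalIntegral.integral_const_mul]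
    · refine intervalIntegral.integral_congr fun θ _ => ?_
      have h1 : Complex.exp (((2 * Real.pi - θ : ℝ) : ℂ) * Complex.I)
          = conj (Complex.exp (θ * Complex.I)) := by
        rw [← Complex.exp_conj, map_mul, Complex.conj_ofReal, Complex.conj_I]
        push_cast
        rw [sub_mul, Complex.exp_sub, Complex.exp_two_pi_mul_I, mul_neg, Complex.exp_neg, one_div]
      simp only [schwarzKernel_two_pi_sub, h1]
      rw [hconj _ (Complex.norm_exp_ofReal_mul_I θ)]
      have := Complex.sub_conj (F (Complex.exp (θ * Complex.I)))
      push_cast at this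
      linear_combination schwarzKernel z θ * this
    · exact ((hcirc.mul hk).comp (continuous_const.sub continuous_id)).intervalIntegrable _ _
  rw [half, c1, c2] at key
  simp only [mul_zero, sub_zero, inv_one, smul_eq_mul] at key
  have hpi : (Real.pi : ℂ) ≠ 0 := by exact_mod_cast Real.pi_ne_zero
  have key2 : (∫ θ in (0 : ℝ)..Real.pi,
        ((F (Complex.exp (θ * Complex.I))).im : ℂ) * schwarzKernel z θ)
      = Real.pi * (F z - F 0) := by
    have h2 : (2 * Complex.I) ≠ 0 := by simp
    apply mul_left_cancel₀ h2
    rw [key]; ring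
  rw [key2]
  field_simp
  ring

/-! ### Sine series and their holomorphic extension -/

/-- The `n`-th sine coefficient of `g` on `[0, π]`. -/
noncomputable def sineCoeff (g : ℝ → ℝ) (n : ℕ) : ℝ :=
  2 / Real.pi * ∫ θ in (0 : ℝ)..Real.pi, g θ * Real.sin (n * θ)

/-- The power series whose imaginary part on the unit circle is the sine series of `g`. -/
noncomputable def sineSeries (g : ℝ → ℝ) (z : ℂ) : ℂ := ∑' n : ℕ, (sineCoeff g n : ℂ) * z ^ n

lemma hasSum_schwarzKernel {z : ℂ} (hz : ‖z‖ < 1) (θ : ℝ) :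
    HasSum (fun n : ℕ => 2 * (Real.sin (n * θ) : ℂ) * z ^ n) (schwarzKernel z θ) := by
  rw [schwarzKernel_eq hz]
  have h1 : ‖z * Complex.exp (θ * Complex.I)‖ < 1 := by
    rwa [norm_mul, Complex.norm_exp_ofReal_mul_I, mul_one]
  have h2 : ‖z * Complex.exp (-(θ * Complex.I))‖ < 1 := by
    rwa [norm_mul, norm_exp_neg_ofReal_mul_I, mul_one]
  refine (((hasSum_geometric_of_norm_lt_one h1).sub
    (hasSum_geometric_of_norm_lt_one h2)).mul_left (-Complex.I)).congr_fun ?_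
  intro n
  have h3 := two_sin_eq (n * θ)
  have e1 : Complex.exp (((n * θ : ℝ) : ℂ) * Complex.I) = Complex.exp (θ * Complex.I) ^ n := by
    rw [← Complex.exp_nat_mul]; push_cast; ring_nf
  have e2 : Complex.exp (-(((n * θ : ℝ) : ℂ) * Complex.I)) =
      Complex.exp (-(θ * Complex.I)) ^ n := by
    rw [← Complex.exp_nat_mul]; push_cast; ring_nf
  rw [e1, e2] at h3
  rw [h3, mul_pow, mul_pow]; ring

/-- Inside the disc the sine series of `g` is given by the Schwarz integral. -/
lemma sineSeries_eq_integral {g : ℝ → ℝ} (hg : Continuous g) {z : ℂ} (hz : ‖z‖ < 1) :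
    sineSeries g z = 1 / (Real.pi : ℂ) * ∫ θ in (0 : ℝ)..Real.pi,
      (g θ : ℂ) * schwarzKernel z θ := by
  obtain ⟨C, hC⟩ := isCompact_Icc.exists_bound_of_continuousOn
    (hg.continuousOn (s := Icc 0 Real.pi))
  have key : HasSum (fun n : ℕ => ∫ θ in (0 : ℝ)..Real.pi,
      (g θ : ℂ) * (2 * (Real.sin (n * θ) : ℂ) * z ^ n))
      (∫ θ in (0 : ℝ)..Real.pi, (g θ : ℂ) * schwarzKernel z θ) := by
    refine intervalIntegral.hasSum_integral_of_dominated_convergence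
      (fun n _ => C * (2 * ‖z‖ ^ n)) ?_ ?_ ?_ ?_ ?_
    · intro n
      exact Continuous.aestronglyMeasurable (by fun_prop)
    · refine fun n => Eventually.of_forall fun θ hθ => ?_
      rw [uIoc_of_le Real.pi_pos.le] at hθ
      have h1 := hC θ ⟨hθ.1.le, hθ.2⟩
      have h2 : |Real.sin (n * θ)| ≤ 1 := Real.abs_sin_le_one _
      have hC0 : 0 ≤ C := (norm_nonneg _).trans h1
      rw [norm_mul, norm_mul, norm_mul, Complex.norm_real, Complex.norm_real, norm_pow,
        Complex.norm_two, Real.norm_eq_abs (Real.sin _)]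
      have : 2 * |Real.sin (n * θ)| * ‖z‖ ^ n ≤ 2 * ‖z‖ ^ n := by
        gcongr; linarith
      gcongr
    · refine Eventually.of_forall fun θ _ => ?_
      exact ((summable_geometric_of_lt_one (norm_nonneg _) hz).mul_left 2).mul_left C
    · exact intervalIntegrable_const
    · exact Eventually.of_forall fun θ _ => (hasSum_schwarzKernel hz θ).mul_left _
  rw [sineSeries, ← (key.mul_left (1 / (Real.pi : ℂ))).tsum_eq]
  refine tsum_congr fun n => ?_
  rw [sineCoeff, show (fun θ : ℝ => (g θ : ℂ) * (2 * (Real.sin (n * θ) : ℂ) * z ^ n)) =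
    fun θ : ℝ => ((g θ * Real.sin (n * θ) : ℝ) : ℂ) * (2 * z ^ n) by
      ext θ; push_cast; ring, intervalIntegral.integral_mul_const, intervalIntegral.integral_ofReal]
  push_cast
  ring

/-- Two integrations by parts: the first boundary term dies because `g` vanishes at both ends, the
second because `sin (n θ)` does. The resulting decay `n⁻²` makes the sine series converge absolutely
on the closed disc. -/
lemma integral_mul_sin_nat_mul {g : ℝ → ℝ} (hg : ContDiff ℝ 2 g) (h0 : g 0 = 0)
    (hpi : g Real.pi = 0) {n : ℕ} (hn : n ≠ 0) :
    ∫ θ in (0 : ℝ)..Real.pi, g θ * Real.sin (n * θ) =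
      -(1 / (n : ℝ) ^ 2) * ∫ θ in (0 : ℝ)..Real.pi, deriv (deriv g) θ * Real.sin (n * θ) := by
  have hn' : (n : ℝ) ≠ 0 := by exact_mod_cast hn
  have hg1 : ContDiff ℝ 1 (deriv g) := by
    have : ContDiff ℝ (1 + 1) g := by simpa [one_add_one_eq_two] using hg
    exact (contDiff_succ_iff_deriv.mp this).2.2
  have hg2 : Continuous (deriv (deriv g)) := hg1.continuous_deriv le_rfl
  have hd1 : ∀ x, HasDerivAt g (deriv g x) x := fun x =>
    (hg.differentiable (by norm_num)).differentiableAt.hasDerivAt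
  have hd2 : ∀ x, HasDerivAt (deriv g) (deriv (deriv g) x) x := fun x =>
    (hg1.differentiable (by norm_num)).differentiableAt.hasDerivAt
  have hlin : ∀ x : ℝ, HasDerivAt (fun x : ℝ => (n : ℝ) * x) n x := fun x => by
    simpa using (hasDerivAt_id x).const_mul (n : ℝ)
  have hv1 : ∀ x : ℝ, HasDerivAt (fun x : ℝ => -(Real.cos (n * x)) / n) (Real.sin (n * x)) x := by
    intro x
    refine (((hlin x).cos.neg).div_const (n : ℝ)).congr_deriv ?_
    field_simp
  have hv2 : ∀ x : ℝ, HasDerivAt (fun x : ℝ => -(Real.sin (n * x)) / (n : ℝ) ^ 2)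
      (-(Real.cos (n * x)) / n) x := by
    intro x
    refine (((hlin x).sin.neg).div_const ((n : ℝ) ^ 2)).congr_deriv ?_
    field_simp
  rw [intervalIntegral.integral_mul_deriv_eq_deriv_mul (fun x _ => hd1 x) (fun x _ => hv1 x)
    (hg1.continuous.intervalIntegrable _ _)
    (Continuous.intervalIntegrable (by fun_prop) _ _), h0, hpi,
    intervalIntegral.integral_mul_deriv_eq_deriv_mul (fun x _ => hd2 x) (fun x _ => hv2 x)
    (hg2.intervalIntegrable _ _)
    (Continuous.intervalIntegrable (by fun_prop) _ _), Real.sin_nat_mul_pi,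
    ← intervalIntegral.integral_const_mul]
  simp only [mul_zero, Real.sin_zero, neg_zero, zero_div, zero_mul, sub_zero, zero_sub, neg_neg]
  refine intervalIntegral.integral_congr fun x _ => ?_
  field_simp

lemma summable_norm_sineCoeff {g : ℝ → ℝ} (hg : ContDiff ℝ 2 g) (h0 : g 0 = 0)
    (hpi : g Real.pi = 0) : Summable fun n : ℕ => ‖(sineCoeff g n : ℂ)‖ := by
  have hg1 : ContDiff ℝ 1 (deriv g) := by
    have : ContDiff ℝ (1 + 1) g := by simpa [one_add_one_eq_two] using hg
    exact (contDiff_succ_iff_deriv.mp this).2.2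
  have hg2 : Continuous (deriv (deriv g)) := hg1.continuous_deriv le_rfl
  obtain ⟨C, hC⟩ := isCompact_Icc.exists_bound_of_continuousOn
    (hg2.continuousOn (s := Icc 0 Real.pi))
  refine Summable.of_nonneg_of_le (fun _ => norm_nonneg _) (fun n => ?_)
    ((Real.summable_one_div_nat_pow.mpr one_lt_two).mul_left (2 * C))
  rw [Complex.norm_real, sineCoeff]
  rcases eq_or_ne n 0 with rfl | hn
  · simp
  rw [integral_mul_sin_nat_mul hg h0 hpi hn, norm_mul, norm_mul]
  have h1 : ‖∫ θ in (0 : ℝ)..Real.pi, deriv (deriv g) θ * Real.sin (n * θ)‖ ≤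
      C * |Real.pi - 0| := by
    refine intervalIntegral.norm_integral_le_of_norm_le_const fun θ hθ => ?_
    rw [uIoc_of_le Real.pi_pos.le] at hθ
    have h1 := hC θ ⟨hθ.1.le, hθ.2⟩
    rw [norm_mul]
    have h2 : ‖Real.sin (n * θ)‖ ≤ 1 := Real.abs_sin_le_one _
    calc _ ≤ C * 1 := mul_le_mul h1 h2 (norm_nonneg _) ((norm_nonneg _).trans h1)
      _ = C := mul_one C
  rw [sub_zero, abs_of_pos Real.pi_pos] at h1
  have hp := Real.pi_pos
  rw [Real.norm_of_nonneg (by positivity), norm_neg, Real.norm_of_nonneg (by positivity)]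
  calc _ ≤ 2 / Real.pi * (1 / (n : ℝ) ^ 2 * (C * Real.pi)) := by gcongr
    _ = _ := by field_simp

/-- A power series with absolutely summable coefficients is holomorphic on the unit disc and
continuous on its closure. -/
lemma diffContOnCl_tsum_mul_pow {c : ℕ → ℂ} (hc : Summable fun n => ‖c n‖) :
    DiffContOnCl ℂ (fun z => ∑' n, c n * z ^ n) (Metric.ball 0 1) := by
  have hb : ∀ (n : ℕ) (z : ℂ), ‖z‖ ≤ 1 → ‖c n * z ^ n‖ ≤ ‖c n‖ := fun n z hz => by
    rw [norm_mul, norm_pow]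
    exact mul_le_of_le_one_right (norm_nonneg _) (pow_le_one₀ (norm_nonneg _) hz)
  constructor
  · refine Complex.differentiableOn_tsum_of_summable_norm hc (fun n => by fun_prop)
      Metric.isOpen_ball fun n z hz => hb n z (mem_ball_zero_iff.mp hz).le
  · rw [closure_ball _ one_ne_zero]
    exact continuousOn_tsum (fun n => by fun_prop) hc
      fun n z hz => hb n z (mem_closedBall_zero_iff.mp hz)

lemma conj_tsum_ofReal_mul_pow (c : ℕ → ℝ) (z : ℂ) :
    ∑' n, (c n : ℂ) * (conj z) ^ n = conj (∑' n, (c n : ℂ) * z ^ n) := by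
  rw [Complex.conj_tsum]
  simp

lemma sineSeries_zero (g : ℝ → ℝ) : sineSeries g 0 = 0 := by
  rw [sineSeries, tsum_eq_single 0 fun n hn => by simp [hn]]
  simp [sineCoeff]

/-! ### Boundary values of sine series: a Plemelj formula -/

lemma mem_slitPlane_one_sub_mul {z w : ℂ} (hz : ‖z‖ < 1) (hw : ‖w‖ = 1) :
    1 - z * w ∈ Complex.slitPlane := by
  left
  have h1 := (Complex.abs_re_le_norm (z * w)).trans_eq (norm_mul z w)
  rw [hw, mul_one] at h1
  rw [Complex.sub_re, Complex.one_re]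
  linarith [le_abs_self (z * w).re]

/-- The factors `1 - z exp(±iθ)` stay in the right half plane, so the sum of their principal
logarithms is a primitive of the kernel. -/
lemma integral_schwarzKernel {z : ℂ} (hz : ‖z‖ < 1) :
    ∫ θ in (0 : ℝ)..Real.pi, schwarzKernel z θ = 2 * (Complex.log (1 + z) - Complex.log (1 - z)) := by
  have hd : ∀ θ : ℝ, HasDerivAt (fun θ : ℝ =>
      Complex.log (1 - z * Complex.exp (θ * Complex.I)) +
      Complex.log (1 - z * Complex.exp (-(θ * Complex.I)))) (schwarzKernel z θ) θ := by
    intro θ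
    have h0 : HasDerivAt (fun θ : ℝ => (θ : ℂ) * Complex.I) Complex.I θ := by
      simpa using (Complex.ofRealCLM.hasDerivAt (x := θ)).mul_const Complex.I
    have h1 := ((h0.cexp.const_mul z).const_sub 1).clog_real
      (mem_slitPlane_one_sub_mul hz (Complex.norm_exp_ofReal_mul_I θ))
    have h2 := ((h0.neg.cexp.const_mul z).const_sub 1).clog_real
      (mem_slitPlane_one_sub_mul hz (norm_exp_neg_ofReal_mul_I θ))
    refine (h1.add h2).congr_deriv ?_
    rw [schwarzKernel_eq hz]
    have h1 := one_sub_mul_ne_zero hz (Complex.norm_exp_ofReal_mul_I θ)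
    have h2 := one_sub_mul_ne_zero hz (norm_exp_neg_ofReal_mul_I θ)
    simp only [Pi.neg_apply]
    generalize Complex.exp (θ * Complex.I) = e at *
    generalize Complex.exp (-(θ * Complex.I)) = e' at *
    field_simp
    ring
  rw [intervalIntegral.integral_eq_sub_of_hasDerivAt (fun θ _ => hd θ)
    ((continuous_schwarzKernel hz).intervalIntegrable _ _)]
  simp only [Complex.exp_neg, Complex.exp_pi_mul_I, Complex.ofReal_zero, zero_mul,
    Complex.exp_zero, inv_one, inv_neg, mul_neg, mul_one, sub_neg_eq_add]
  ring

/-- The half-angle forms of `1 ± exp(iθ)` have arguments `θ / 2` and `θ / 2 - π / 2`. Their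
difference gives the term `π i`, which becomes the imaginary part `g θ` in the Plemelj formula. -/
lemma two_mul_log_one_add_sub_log_one_sub {θ : ℝ} (hθ : θ ∈ Ioo 0 Real.pi) :
    2 * (Complex.log (1 + Complex.exp (θ * Complex.I)) -
      Complex.log (1 - Complex.exp (θ * Complex.I))) =
    ((Real.log (1 + Real.cos θ) - Real.log (1 - Real.cos θ) : ℝ) : ℂ) + Real.pi * Complex.I := by
  obtain ⟨h0, hpi⟩ := hθ
  have hs : 0 < Real.sin (θ / 2) := Real.sin_pos_of_pos_of_lt_pi (by linarith) (by linarith)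
  have hc : 0 < Real.cos (θ / 2) := Real.cos_pos_of_mem_Ioo ⟨by linarith, by linarith⟩
  have hsq := Real.sin_sq_add_cos_sq (θ / 2)
  have hcos : Real.cos θ = 2 * Real.cos (θ / 2) ^ 2 - 1 := by
    rw [← Real.cos_two_mul]; ring_nf
  have hsin : Real.sin θ = 2 * Real.sin (θ / 2) * Real.cos (θ / 2) := by
    rw [← Real.sin_two_mul]; ring_nf
  have e1 : 1 + Complex.exp (θ * Complex.I) = ((2 * Real.cos (θ / 2) : ℝ) : ℂ) *
      Complex.exp ((θ / 2 : ℝ) * Complex.I) := by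
    rw [Complex.exp_mul_I, Complex.exp_mul_I, ← Complex.ofReal_cos, ← Complex.ofReal_sin,
      ← Complex.ofReal_cos, ← Complex.ofReal_sin, hcos, hsin]
    generalize Real.cos (θ / 2) = c
    generalize Real.sin (θ / 2) = s
    push_cast
    ring
  have e2 : 1 - Complex.exp (θ * Complex.I) = ((2 * Real.sin (θ / 2) : ℝ) : ℂ) *
      Complex.exp ((θ / 2 - Real.pi / 2 : ℝ) * Complex.I) := by
    rw [Complex.exp_mul_I, Complex.exp_mul_I, ← Complex.ofReal_cos, ← Complex.ofReal_sin,
      ← Complex.ofReal_cos, ← Complex.ofReal_sin, Real.cos_sub_pi_div_two,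
      Real.sin_sub_pi_div_two, hcos, hsin]
    have hsq' := congrArg Complex.ofReal hsq
    generalize Real.cos (θ / 2) = c at hsq'
    generalize Real.sin (θ / 2) = s at hsq'
    push_cast at hsq' ⊢
    linear_combination (-2 : ℂ) * hsq'
  have l1 : Complex.log (1 + Complex.exp (θ * Complex.I)) =
      (Real.log (2 * Real.cos (θ / 2)) : ℂ) + (θ / 2 : ℝ) * Complex.I := by
    rw [e1, Complex.log_ofReal_mul (by positivity) (Complex.exp_ne_zero _),
      Complex.log_exp (by simp; linarith) (by simp; linarith)]
  have l2 : Complex.log (1 - Complex.exp (θ * Complex.I)) =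
      (Real.log (2 * Real.sin (θ / 2)) : ℂ) + (θ / 2 - Real.pi / 2 : ℝ) * Complex.I := by
    rw [e2, Complex.log_ofReal_mul (by positivity) (Complex.exp_ne_zero _),
      Complex.log_exp (by simp; linarith) (by simp; linarith)]
  have r1 : Real.log (1 + Real.cos θ) =
      2 * Real.log (2 * Real.cos (θ / 2)) - Real.log 2 := by
    rw [hcos, show 1 + (2 * Real.cos (θ / 2) ^ 2 - 1) = (2 * Real.cos (θ / 2)) ^ 2 / 2 by ring,
      Real.log_div (by positivity) two_ne_zero, Real.log_pow]
    norm_num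
  have r2 : Real.log (1 - Real.cos θ) =
      2 * Real.log (2 * Real.sin (θ / 2)) - Real.log 2 := by
    rw [hcos, show 1 - (2 * Real.cos (θ / 2) ^ 2 - 1) = (2 * Real.sin (θ / 2)) ^ 2 / 2 by
      linear_combination (-2 : ℝ) * hsq,
      Real.log_div (by positivity) two_ne_zero, Real.log_pow]
    norm_num
  rw [l1, l2, r1, r2]
  push_cast
  ring

lemma cos_ne_cos {θ θ' : ℝ} (hθ : θ ∈ Icc 0 Real.pi) (hθ' : θ' ∈ Icc 0 Real.pi) (h : θ' ≠ θ) :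
    Real.cos θ - Real.cos θ' ≠ 0 := by
  intro h'
  exact h (Real.injOn_cos hθ' hθ (by linarith))

/-- The regular part of the singular integral. -/
noncomputable def hilbertIntegrand (g : ℝ → ℝ) (θ θ' : ℝ) : ℝ :=
  (g θ' - g θ) * (Real.sin θ' / (Real.cos θ - Real.cos θ'))

/-- Away from `θ` the integrand is a quotient of divided differences of `g` and `cos`, which extends
continuously since the derivative `-sin θ` of `cos` is nonzero there. The value at `θ` itself is a
division by zero and is discarded as a null set. -/
lemma intervalIntegrable_hilbertIntegrand {g : ℝ → ℝ} (hg : Differentiable ℝ g) {θ : ℝ}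
    (hθ : θ ∈ Ioo 0 Real.pi) :
    IntervalIntegrable (hilbertIntegrand g θ) volume 0 Real.pi := by
  have hc : ∀ f : ℝ → ℝ, Differentiable ℝ f → Continuous (dslope f θ) := by
    intro f hf
    rw [← continuousOn_univ]
    exact (continuousOn_dslope univ_mem).mpr ⟨hf.continuous.continuousOn, hf.differentiableAt⟩
  have hne : ∀ x ∈ uIcc 0 Real.pi, dslope Real.cos θ x ≠ 0 := by
    intro x hx
    rw [uIcc_of_le Real.pi_pos.le] at hx
    rcases eq_or_ne x θ with rfl | h
    · rw [dslope_same, Real.deriv_cos]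
      exact neg_ne_zero.mpr (Real.sin_pos_of_mem_Ioo hθ).ne'
    · rw [dslope_of_ne _ h, slope_def_field]
      refine div_ne_zero ?_ (sub_ne_zero.mpr h)
      have := cos_ne_cos (Ioo_subset_Icc_self hθ) hx h
      exact fun h' => this (by linarith)
  have hcont : ContinuousOn (fun x => -(dslope g θ x * Real.sin x / dslope Real.cos θ x))
      (uIcc 0 Real.pi) :=
    (ContinuousOn.div (((hc g hg).mul Real.continuous_sin).continuousOn)
      (hc _ Real.differentiable_cos).continuousOn hne).neg
  refine hcont.intervalIntegrable.congr_ae ?_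
  refine ae_restrict_of_ae ?_
  filter_upwards [compl_mem_ae_iff.mpr (measure_singleton θ)] with x hx
  have hx' : x ≠ θ := hx
  have hx2 := sub_ne_zero.mpr hx'
  rw [dslope_of_ne _ hx', dslope_of_ne _ hx', slope_def_field, slope_def_field, hilbertIntegrand,
    ← neg_sub (Real.cos x), div_neg, mul_neg]
  congr 1
  rw [div_mul_eq_mul_div, div_div_div_cancel_right₀ hx2, mul_div_assoc]

/-- Moving radially inwards brings a point of the circle closer to `1` by at most a factor `2`.
Applied to both factors of the denominator, this gives a bound on the Schwarz kernel uniform in the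
radius. -/
lemma norm_one_sub_le_two_mul {w : ℂ} (hw : ‖w‖ = 1) {t : ℝ} (h0 : 0 ≤ t) (h1 : t ≤ 1) :
    ‖1 - w‖ ≤ 2 * ‖1 - t * w‖ := by
  have e : 1 - w = (1 - t * w) - ((1 - t : ℝ) : ℂ) * w := by push_cast; ring
  have h2 : ‖((1 - t : ℝ) : ℂ) * w‖ = 1 - t := by
    rw [norm_mul, hw, mul_one, Complex.norm_real, Real.norm_of_nonneg (by linarith)]
  have h3 : ‖(t : ℂ) * w‖ = t := by
    rw [norm_mul, hw, mul_one, Complex.norm_real, Real.norm_of_nonneg h0]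
  have h4 := norm_sub_norm_le (1 : ℂ) (t * w)
  rw [norm_one, h3] at h4
  have h5 := norm_sub_le (1 - t * w) (((1 - t : ℝ) : ℂ) * w)
  rw [← e, h2] at h5
  linarith

lemma schwarzKernel_denom_exp (θ θ' : ℝ) :
    1 - 2 * Complex.exp (θ * Complex.I) * Real.cos θ' + Complex.exp (θ * Complex.I) ^ 2 =
      Complex.exp (θ * Complex.I) * ((2 * (Real.cos θ - Real.cos θ') : ℝ) : ℂ) := by
  simp only [Complex.ofReal_mul, Complex.ofReal_sub, Complex.ofReal_ofNat]
  linear_combination -exp_mul_I_mul_exp_neg_mul_I θ - Complex.exp (θ * Complex.I) * two_cos_eq θ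

lemma schwarzKernel_exp {θ θ' : ℝ} (h : Real.cos θ - Real.cos θ' ≠ 0) :
    schwarzKernel (Complex.exp (θ * Complex.I)) θ' =
      ((Real.sin θ' / (Real.cos θ - Real.cos θ') : ℝ) : ℂ) := by
  rw [schwarzKernel, schwarzKernel_denom_exp]
  have h' : (Real.cos θ : ℂ) - Real.cos θ' ≠ 0 := by exact_mod_cast h
  have := Complex.exp_ne_zero (θ * Complex.I)
  push_cast at h' ⊢
  field_simp

lemma norm_schwarzKernel_le {θ θ' t : ℝ} (h : Real.cos θ - Real.cos θ' ≠ 0) (h0 : 0 ≤ t)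
    (h1 : t < 1) : ‖schwarzKernel (t * Complex.exp (θ * Complex.I)) θ'‖ ≤
      4 * ‖Real.sin θ' / (Real.cos θ - Real.cos θ')‖ := by
  have hz : ‖(t : ℂ) * Complex.exp (θ * Complex.I)‖ = t := by
    rw [norm_mul, Complex.norm_exp_ofReal_mul_I, mul_one, Complex.norm_real,
      Real.norm_of_nonneg h0]
  have hd : 2 * ‖Real.cos θ - Real.cos θ'‖ ≤ 4 * ‖1 - 2 * (t * Complex.exp (θ * Complex.I)) *
      Real.cos θ' + (t * Complex.exp (θ * Complex.I)) ^ 2‖ := by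
    have e := congrArg norm (schwarzKernel_denom_exp θ θ')
    rw [schwarzKernel_denom_eq, norm_mul, norm_mul, Complex.norm_exp_ofReal_mul_I, one_mul,
      Complex.norm_real, norm_mul, Real.norm_two] at e
    rw [← e, schwarzKernel_denom_eq, norm_mul, mul_assoc (t : ℂ), mul_assoc (t : ℂ)]
    have a1 := norm_one_sub_le_two_mul (w := Complex.exp (θ * Complex.I) *
      Complex.exp (θ' * Complex.I)) (by
        rw [norm_mul, Complex.norm_exp_ofReal_mul_I, Complex.norm_exp_ofReal_mul_I, one_mul])
        h0 h1.le
    have a2 := norm_one_sub_le_two_mul (w := Complex.exp (θ * Complex.I) *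
      Complex.exp (-(θ' * Complex.I))) (by
        rw [norm_mul, Complex.norm_exp_ofReal_mul_I, norm_exp_neg_ofReal_mul_I, one_mul])
        h0 h1.le
    calc _ ≤ _ := mul_le_mul a1 a2 (norm_nonneg _) (by positivity)
      _ = _ := by ring
  have hp : 0 < ‖Real.cos θ - Real.cos θ'‖ := norm_pos_iff.mpr h
  have hs : ‖(2 : ℂ) * (t * Complex.exp (θ * Complex.I)) * Real.sin θ'‖ ≤ 2 * ‖Real.sin θ'‖ := by
    rw [norm_mul, norm_mul, hz, Complex.norm_two, Complex.norm_real]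
    have := mul_le_mul_of_nonneg_right h1.le (norm_nonneg (Real.sin θ'))
    linarith
  rw [schwarzKernel, norm_div, norm_div, ← mul_div_assoc, div_le_div_iff₀ (by linarith) hp]
  calc _ ≤ (2 * ‖Real.sin θ'‖) * ‖Real.cos θ - Real.cos θ'‖ := by gcongr
    _ ≤ _ := by nlinarith [norm_nonneg (Real.sin θ')]

/-- The boundary values of the sine series: a Plemelj formula. -/
theorem sineSeries_exp_mul_I {g : ℝ → ℝ} (hg : ContDiff ℝ 2 g) (h0 : g 0 = 0)
    (hpi : g Real.pi = 0) {θ : ℝ} (hθ : θ ∈ Ioo 0 Real.pi) :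
    sineSeries g (Complex.exp (θ * Complex.I)) =
      ((1 / Real.pi * ((∫ θ' in (0 : ℝ)..Real.pi, hilbertIntegrand g θ θ') +
        g θ * (Real.log (1 + Real.cos θ) - Real.log (1 - Real.cos θ))) : ℝ) : ℂ)
        + g θ * Complex.I := by
  have hdiff : Differentiable ℝ g := hg.differentiable (by norm_num)
  have hgc : Continuous g := hg.continuous
  set ζ := Complex.exp (θ * Complex.I) with hζ
  have hζn : ‖ζ‖ = 1 := Complex.norm_exp_ofReal_mul_I θ
  have hnorm : ∀ t : ℝ, 0 ≤ t → ‖(t : ℂ) * ζ‖ = t := fun t ht => by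
    rw [norm_mul, hζn, mul_one, Complex.norm_real, Real.norm_of_nonneg ht]
  have hev : ∀ᶠ t : ℝ in 𝓝[<] 1, 0 < t ∧ t < 1 := by
    filter_upwards [Ioo_mem_nhdsLT (zero_lt_one (α := ℝ))] with t ht using ht
  have htend : Tendsto (fun t : ℝ => (t : ℂ) * ζ) (𝓝[<] 1) (𝓝 ζ) := by
    have : Continuous fun t : ℝ => (t : ℂ) * ζ := by fun_prop
    have h1 := this.tendsto 1
    rw [Complex.ofReal_one, one_mul] at h1
    exact h1.mono_left nhdsWithin_le_nhds
  have lim1 : Tendsto (fun t : ℝ => sineSeries g (t * ζ)) (𝓝[<] 1) (𝓝 (sineSeries g ζ)) := by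
    have hc := (diffContOnCl_tsum_mul_pow (summable_norm_sineCoeff hg h0 hpi)).continuousOn
    rw [closure_ball _ one_ne_zero] at hc
    refine (hc ζ (by simp [hζn])).tendsto.comp ?_
    refine tendsto_nhdsWithin_iff.mpr ⟨htend, ?_⟩
    filter_upwards [hev] with t ht
    rw [mem_closedBall_zero_iff, hnorm t ht.1.le]
    exact ht.2.le
  -- Subtracting the constant `g θ` removes the singularity, so dominated convergence applies along
  -- the radius; the constant part is handled by the closed form of the kernel's integral.
  have lim2 : Tendsto (fun t : ℝ => ∫ θ' in (0 : ℝ)..Real.pi,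
      ((g θ' - g θ : ℝ) : ℂ) * schwarzKernel (t * ζ) θ') (𝓝[<] 1)
      (𝓝 (∫ θ' in (0 : ℝ)..Real.pi, ((hilbertIntegrand g θ θ' : ℝ) : ℂ))) := by
    refine intervalIntegral.tendsto_integral_filter_of_dominated_convergence
      (fun θ' => 4 * ‖hilbertIntegrand g θ θ'‖) ?_ ?_ ?_ ?_
    · filter_upwards [hev] with t ht
      have hk := continuous_schwarzKernel (z := t * ζ) (by rw [hnorm t ht.1.le]; exact ht.2)
      exact Continuous.aestronglyMeasurable (by fun_prop)
    · filter_upwards [hev] with t ht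
      filter_upwards [compl_mem_ae_iff.mpr (measure_singleton θ)] with x hx hxm
      rw [uIoc_of_le Real.pi_pos.le] at hxm
      have hc := cos_ne_cos (Ioo_subset_Icc_self hθ) (Ioc_subset_Icc_self hxm) hx
      have := norm_schwarzKernel_le hc ht.1.le ht.2
      rw [hilbertIntegrand, norm_mul, norm_mul, Complex.norm_real]
      calc _ ≤ ‖g x - g θ‖ * _ := mul_le_mul_of_nonneg_left this (norm_nonneg _)
        _ = _ := by ring
    · exact (intervalIntegrable_hilbertIntegrand hdiff hθ).norm.const_mul 4
    · filter_upwards [compl_mem_ae_iff.mpr (measure_singleton θ)] with x hx hxm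
      rw [uIoc_of_le Real.pi_pos.le] at hxm
      have hc := cos_ne_cos (Ioo_subset_Icc_self hθ) (Ioc_subset_Icc_self hxm) hx
      rw [hilbertIntegrand, Complex.ofReal_mul, ← schwarzKernel_exp hc]
      refine Tendsto.const_mul _ ?_
      have hcont : ContinuousAt (fun z => schwarzKernel z x) ζ := by
        unfold schwarzKernel
        refine ContinuousAt.div (by fun_prop) (by fun_prop) ?_
        rw [hζ, schwarzKernel_denom_exp]
        refine mul_ne_zero (Complex.exp_ne_zero _) ?_
        exact_mod_cast mul_ne_zero two_ne_zero hc
      exact hcont.tendsto.comp htend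
  have lim3 : Tendsto (fun t : ℝ => 2 * (Complex.log (1 + t * ζ) - Complex.log (1 - t * ζ)))
      (𝓝[<] 1) (𝓝 (2 * (Complex.log (1 + ζ) - Complex.log (1 - ζ)))) := by
    have hsin := Real.sin_pos_of_mem_Ioo hθ
    have him : ζ.im = Real.sin θ := Complex.exp_ofReal_mul_I_im θ
    refine Tendsto.const_mul _ (Tendsto.sub ?_ ?_)
    · exact (htend.const_add 1).clog (Or.inr (by simp [him, hsin.ne']))
    · exact (htend.const_sub 1).clog (Or.inr (by simp [him, hsin.ne']))
  rw [two_mul_log_one_add_sub_log_one_sub hθ] at lim3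
  have lim4 := (lim2.add (lim3.const_mul (g θ : ℂ))).const_mul (1 / (Real.pi : ℂ))
  have heq : (fun t : ℝ => sineSeries g (t * ζ)) =ᶠ[𝓝[<] 1] fun t : ℝ =>
      1 / (Real.pi : ℂ) * ((∫ θ' in (0 : ℝ)..Real.pi,
      ((g θ' - g θ : ℝ) : ℂ) * schwarzKernel (t * ζ) θ') +
      (g θ : ℂ) * (2 * (Complex.log (1 + t * ζ) - Complex.log (1 - t * ζ)))) := by
    filter_upwards [hev] with t ht
    have hz : ‖(t : ℂ) * ζ‖ < 1 := by rw [hnorm t ht.1.le]; exact ht.2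
    have hk := continuous_schwarzKernel hz
    rw [sineSeries_eq_integral hgc hz, ← integral_schwarzKernel hz,
      ← intervalIntegral.integral_const_mul (g θ : ℂ), ← intervalIntegral.integral_add]
    · congr 2
      ext θ'
      push_cast
      ring
    · exact Continuous.intervalIntegrable (by fun_prop) _ _
    · exact Continuous.intervalIntegrable (by fun_prop) _ _
  rw [tendsto_nhds_unique lim1 (lim4.congr' heq.symm), intervalIntegral.integral_ofReal]
  have hp : (Real.pi : ℂ) ≠ 0 := by exact_mod_cast Real.pi_ne_zero
  push_cast
  field_simp
  ring

namespace Model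

/-! ### The angular parametrization of the cut -/

/-- The sign and stability conditions on the parameters. -/
structure Stable (M : Model) : Prop where
  lam₁_pos : 0 < M.lam₁
  lam₂_pos : 0 < M.lam₂
  up₁_pos : 0 < M.mu₁ * M.c₁
  up₂_pos : 0 < M.mu₂ * M.c₂
  up₁_lt : M.mu₁ * M.c₁ < M.lam₁

variable {M : Model}

/-- The number `2 √(μ₁ c₁ λ₁)`. -/
noncomputable def rho (M : Model) : ℝ := 2 * √(M.mu₁ * M.c₁ * M.lam₁)

lemma Stable.rho_pos (h : M.Stable) : 0 < M.rho :=
  mul_pos two_pos (Real.sqrt_pos.mpr (mul_pos h.up₁_pos h.lam₁_pos))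

lemma Stable.rho_sq (h : M.Stable) : M.rho ^ 2 = 4 * (M.mu₁ * M.c₁) * M.lam₁ := by
  rw [rho, mul_pow, Real.sq_sqrt (mul_pos h.up₁_pos h.lam₁_pos).le]; ring

lemma Stable.rho_lt_two_mul (h : M.Stable) : M.rho < 2 * M.lam₁ := by
  have := h.rho_sq
  have := h.lam₁_pos
  have := h.up₁_lt
  exact lt_of_pow_lt_pow_left₀ 2 (by positivity) (by nlinarith)

/-- Strict arithmetic-geometric mean inequality, from `μ₁c₁ ≠ λ₁`. It is what separates the roots
from `1`, uniformly in `θ`. -/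
lemma Stable.rho_lt_add (h : M.Stable) : M.rho < M.mu₁ * M.c₁ + M.lam₁ := by
  have h1 := h.rho_sq
  have h2 := h.lam₁_pos
  have h3 := h.up₁_lt
  have h4 := h.up₁_pos
  exact lt_of_pow_lt_pow_left₀ 2 (by linarith) (by nlinarith [sq_pos_of_pos (sub_pos.mpr h3)])

lemma Stable.r₁_pos (h : M.Stable) : 0 < M.r₁ := Real.sqrt_pos.mpr (div_pos h.lam₁_pos h.up₁_pos)

lemma Stable.r₁_sq (h : M.Stable) : M.mu₁ * M.c₁ * M.r₁ ^ 2 = M.lam₁ := by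
  rw [r₁, Real.sq_sqrt (div_pos h.lam₁_pos h.up₁_pos).le, mul_div_cancel₀ _ h.up₁_pos.ne']

lemma Stable.one_lt_r₁ (h : M.Stable) : 1 < M.r₁ := by
  rw [r₁, Real.lt_sqrt zero_le_one, one_pow, one_lt_div h.up₁_pos]
  exact h.up₁_lt

lemma Stable.rho_mul_r₁ (h : M.Stable) : M.rho * M.r₁ = 2 * M.lam₁ := by
  have h1 := h.rho_pos
  have h2 := h.r₁_pos
  have h3 := h.lam₁_pos
  rw [← sq_eq_sq₀ (by positivity) (by positivity), mul_pow, h.rho_sq]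
  linear_combination 4 * M.lam₁ * h.r₁_sq

lemma Stable.rho_eq (h : M.Stable) : M.rho = 2 * (M.mu₁ * M.c₁) * M.r₁ := by
  have h1 := h.r₁_sq
  have h2 := h.rho_mul_r₁
  apply mul_right_cancel₀ h.r₁_pos.ne'
  rw [h2, ← h1]; ring

/-- The sum `μ₂ c₂ y + λ₂ / y` at the point of the cut with angle `θ`. -/
noncomputable def level (M : Model) (θ : ℝ) : ℝ := M.total - M.rho * Real.cos θ

lemma Stable.lt_level (h : M.Stable) (θ : ℝ) : M.mu₂ * M.c₂ + M.lam₂ < M.level θ := by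
  have h1 := h.rho_lt_add
  have h2 := mul_le_mul_of_nonneg_left (Real.cos_le_one θ) h.rho_pos.le
  rw [level, total]
  linarith

lemma Stable.discr_pos (h : M.Stable) (θ : ℝ) :
    0 < M.level θ ^ 2 - 4 * (M.mu₂ * M.c₂) * M.lam₂ := by
  nlinarith [h.lt_level θ, h.lam₂_pos, h.up₂_pos, sq_nonneg (M.mu₂ * M.c₂ - M.lam₂)]

/-- The point of the cut `[y₁, y₂]` with angle `θ`. -/
noncomputable def root (M : Model) (θ : ℝ) : ℝ :=
  (M.level θ - √(M.level θ ^ 2 - 4 * (M.mu₂ * M.c₂) * M.lam₂)) / (2 * (M.mu₂ * M.c₂))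

/-- The point of the cut `[y₃, y₄]` with angle `θ`. -/
noncomputable def coRoot (M : Model) (θ : ℝ) : ℝ :=
  (M.level θ + √(M.level θ ^ 2 - 4 * (M.mu₂ * M.c₂) * M.lam₂)) / (2 * (M.mu₂ * M.c₂))

lemma Stable.root_add_coRoot (h : M.Stable) (θ : ℝ) :
    M.mu₂ * M.c₂ * (M.root θ + M.coRoot θ) = M.level θ := by
  have h2 := h.up₂_pos
  rw [root, coRoot]
  generalize M.mu₂ * M.c₂ = B at *
  field_simp
  ring

lemma Stable.root_mul_coRoot (h : M.Stable) (θ : ℝ) :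
    M.mu₂ * M.c₂ * (M.root θ * M.coRoot θ) = M.lam₂ := by
  have h2 := h.up₂_pos
  have h3 := Real.sq_sqrt (h.discr_pos θ).le
  rw [root, coRoot]
  generalize √(M.level θ ^ 2 - 4 * (M.mu₂ * M.c₂) * M.lam₂) = q at *
  generalize M.mu₂ * M.c₂ = B at *
  field_simp
  linear_combination -h3

lemma Stable.quadratic_eq (h : M.Stable) (θ y : ℝ) :
    M.mu₂ * M.c₂ * y ^ 2 - M.level θ * y + M.lam₂ =
      M.mu₂ * M.c₂ * ((y - M.root θ) * (y - M.coRoot θ)) := by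
  linear_combination y * h.root_add_coRoot θ - h.root_mul_coRoot θ

lemma Stable.root_lt_coRoot (h : M.Stable) (θ : ℝ) : M.root θ < M.coRoot θ := by
  have h1 := Real.sqrt_pos.mpr (h.discr_pos θ)
  have h2 := h.up₂_pos
  rw [root, coRoot]
  gcongr
  linarith

lemma Stable.coRoot_pos (h : M.Stable) (θ : ℝ) : 0 < M.coRoot θ := by
  have h1 := Real.sqrt_pos.mpr (h.discr_pos θ)
  have h2 := h.up₂_pos
  have h3 := h.lt_level θ
  have h4 := h.lam₂_pos
  rw [coRoot]
  apply div_pos <;> linarith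

lemma Stable.root_pos (h : M.Stable) (θ : ℝ) : 0 < M.root θ := by
  have h1 : 0 < M.mu₂ * M.c₂ * (M.root θ * M.coRoot θ) := by
    rw [h.root_mul_coRoot]; exact h.lam₂_pos
  exact pos_of_mul_pos_left (pos_of_mul_pos_right h1 h.up₂_pos.le) (h.coRoot_pos θ).le

/-- The quadratic `μ₂c₂ y² - level θ * y + λ₂` is negative at `y = 1`, so `1` lies strictly between
its roots. -/
lemma Stable.root_lt_one_lt_coRoot (h : M.Stable) (θ : ℝ) : M.root θ < 1 ∧ 1 < M.coRoot θ := by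
  have h1 := h.quadratic_eq θ 1
  have h2 := h.lt_level θ
  have h3 := h.up₂_pos
  have h4 := h.root_lt_coRoot θ
  have h5 : (1 - M.root θ) * (1 - M.coRoot θ) < 0 := by
    by_contra hc
    push Not at hc
    nlinarith [mul_nonneg h3.le hc]
  rcases mul_neg_iff.mp h5 with h6 | h6 <;> constructor <;> linarith

lemma Stable.level_mul_root (h : M.Stable) (θ : ℝ) :
    M.level θ * M.root θ = M.mu₂ * M.c₂ * M.root θ ^ 2 + M.lam₂ := by
  have := h.quadratic_eq θ (M.root θ)
  rw [sub_self, zero_mul, mul_zero] at this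
  linarith

lemma Stable.sub_total_mul_root (h : M.Stable) (θ : ℝ) :
    M.mu₂ * M.c₂ * M.root θ ^ 2 - M.total * M.root θ + M.lam₂ =
      -(M.rho * Real.cos θ * M.root θ) := by
  have := h.level_mul_root θ
  rw [level] at this
  linarith

lemma Stable.mul_root_sq_lt (h : M.Stable) (θ : ℝ) : M.mu₂ * M.c₂ * M.root θ ^ 2 < M.lam₂ := by
  have h1 := h.root_mul_coRoot θ
  have h2 := mul_lt_mul_of_pos_left (h.root_lt_coRoot θ) (mul_pos h.up₂_pos (h.root_pos θ))
  nlinarith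

lemma Stable.mul_root_mul_root_lt (h : M.Stable) (θ θ' : ℝ) :
    M.mu₂ * M.c₂ * (M.root θ * M.root θ') < M.lam₂ := by
  have h1 := h.mul_root_sq_lt θ
  have h2 := h.mul_root_sq_lt θ'
  nlinarith [h.up₂_pos, mul_nonneg h.up₂_pos.le (sq_nonneg (M.root θ - M.root θ'))]

/-- The function `s - μ₂ c₂ y - λ₂ / y`, which maps the cut `[y₁, y₂]` onto `[-ρ, ρ]`. -/
noncomputable def height (M : Model) (y : ℝ) : ℝ := M.total - M.mu₂ * M.c₂ * y - M.lam₂ / y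

lemma Stable.height_root (h : M.Stable) (θ : ℝ) :
    M.height (M.root θ) = M.rho * Real.cos θ := by
  have h1 := h.sub_total_mul_root θ
  have h2 := h.root_pos θ
  rw [height]
  field_simp
  linarith

lemma height_sub_height {y ξ : ℝ} (hy : y ≠ 0) (hξ : ξ ≠ 0) :
    M.height y - M.height ξ = (ξ - y) * (M.mu₂ * M.c₂ * y * ξ - M.lam₂) / (y * ξ) := by
  rw [height, height]
  field_simp
  ring

lemma hasDerivAt_height {y : ℝ} (hy : y ≠ 0) :
    HasDerivAt M.height (M.lam₂ / y ^ 2 - M.mu₂ * M.c₂) y := by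
  have h1 := ((hasDerivAt_id y).const_mul (M.mu₂ * M.c₂)).const_sub M.total
  have h2 := (hasDerivAt_inv hy).const_mul M.lam₂
  refine ((h1.sub h2).congr_deriv ?_).congr_of_eventuallyEq ?_
  · field_simp; ring
  · exact Eventually.of_forall fun x => by simp [height, div_eq_mul_inv]

lemma Stable.contDiff_root (h : M.Stable) : ContDiff ℝ 2 M.root := by
  have h1 : ContDiff ℝ 2 M.level := by unfold level; fun_prop
  unfold root
  exact (h1.sub (((h1.pow 2).sub contDiff_const).sqrt fun θ => (h.discr_pos θ).ne')).div_const _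

/-- The absolute value of the derivative of `root`. -/
noncomputable def jac (M : Model) (θ : ℝ) : ℝ :=
  M.rho * Real.sin θ / (M.lam₂ / M.root θ ^ 2 - M.mu₂ * M.c₂)

lemma Stable.height_deriv_pos (h : M.Stable) (θ : ℝ) :
    0 < M.lam₂ / M.root θ ^ 2 - M.mu₂ * M.c₂ := by
  have h1 := h.mul_root_sq_lt θ
  have h2 := h.root_pos θ
  rw [sub_pos, lt_div_iff₀ (by positivity)]
  exact h1

/-- Implicit differentiation of `height (root θ) = rho * cos θ`. -/
lemma Stable.hasDerivAt_root (h : M.Stable) (θ : ℝ) : HasDerivAt M.root (-M.jac θ) θ := by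
  have h1 : HasDerivAt M.root (deriv M.root θ) θ :=
    (h.contDiff_root.differentiable (by norm_num)).differentiableAt.hasDerivAt
  have h2 := (hasDerivAt_height (M := M) (h.root_pos θ).ne').comp θ h1
  have h3 : HasDerivAt (M.height ∘ M.root) (M.rho * -Real.sin θ) θ := by
    have : M.height ∘ M.root = fun θ => M.rho * Real.cos θ := funext fun θ => h.height_root θ
    rw [this]
    exact (Real.hasDerivAt_cos θ).const_mul _
  have h4 := h2.unique h3
  have h5 : deriv M.root θ = -M.jac θ := by
    have := (h.height_deriv_pos θ).ne'
    rw [jac, eq_neg_iff_add_eq_zero]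
    field_simp
    linarith
  rwa [← h5]

lemma Stable.continuous_root (h : M.Stable) : Continuous M.root := h.contDiff_root.continuous

lemma Stable.jac_nonneg (h : M.Stable) {θ : ℝ} (hθ : θ ∈ Icc 0 Real.pi) : 0 ≤ M.jac θ :=
  div_nonneg (mul_nonneg h.rho_pos.le (Real.sin_nonneg_of_mem_Icc hθ)) (h.height_deriv_pos θ).le

lemma Stable.height_root_lt_iff (h : M.Stable) (θ θ' : ℝ) :
    M.height (M.root θ) < M.height (M.root θ') ↔ M.root θ < M.root θ' := by
  have h1 := h.root_pos θ
  have h2 := h.root_pos θ'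
  have h3 := h.mul_root_mul_root_lt θ θ'
  rw [← sub_neg, height_sub_height h1.ne' h2.ne', div_neg_iff]
  have h4 : M.mu₂ * M.c₂ * M.root θ * M.root θ' - M.lam₂ < 0 := by linarith
  have h5 : 0 < M.root θ * M.root θ' := by positivity
  constructor
  · rintro (h6 | h6)
    · linarith
    · nlinarith
  · intro h6
    right
    exact ⟨mul_neg_of_pos_of_neg (sub_pos.mpr h6) h4, h5⟩

lemma Stable.strictAntiOn_root (h : M.Stable) : StrictAntiOn M.root (Icc 0 Real.pi) := by
  intro a ha b hb hab
  rw [← h.height_root_lt_iff, h.height_root, h.height_root]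
  exact mul_lt_mul_of_pos_left (Real.strictAntiOn_cos ha hb hab) h.rho_pos

lemma Stable.image_root (h : M.Stable) :
    M.root '' Ioo 0 Real.pi = Ioo (M.root Real.pi) (M.root 0) := by
  apply Subset.antisymm
  · rintro _ ⟨θ, hθ, rfl⟩
    exact ⟨h.strictAntiOn_root (Ioo_subset_Icc_self hθ) (right_mem_Icc.mpr Real.pi_pos.le) hθ.2,
      h.strictAntiOn_root (left_mem_Icc.mpr Real.pi_pos.le) (Ioo_subset_Icc_self hθ) hθ.1⟩
  · exact intermediate_value_Ioo' Real.pi_pos.le h.continuous_root.continuousOn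

lemma Stable.root_pi_lt_root_zero (h : M.Stable) : M.root Real.pi < M.root 0 :=
  h.strictAntiOn_root (left_mem_Icc.mpr Real.pi_pos.le) (right_mem_Icc.mpr Real.pi_pos.le)
    Real.pi_pos

/-- Integration over the cut in terms of the angle. -/
lemma Stable.integral_cut (h : M.Stable) {E : Type*} [NormedAddCommGroup E] [NormedSpace ℝ E]
    {f G : ℝ → E} (hG : IntervalIntegrable G volume 0 Real.pi)
    (hfG : ∀ θ ∈ Ioo 0 Real.pi, M.jac θ • f (M.root θ) = G θ) :
    IntervalIntegrable f volume (M.root Real.pi) (M.root 0) ∧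
      ∫ y in (M.root Real.pi)..(M.root 0), f y = ∫ θ in (0 : ℝ)..Real.pi, G θ := by
  have hinj : InjOn M.root (Ioo 0 Real.pi) := h.strictAntiOn_root.injOn.mono Ioo_subset_Icc_self
  have hd : ∀ θ ∈ Ioo 0 Real.pi, HasDerivWithinAt M.root (-M.jac θ) (Ioo 0 Real.pi) θ :=
    fun θ _ => (h.hasDerivAt_root θ).hasDerivWithinAt
  have heq : EqOn (fun θ => |-M.jac θ| • f (M.root θ)) G (Ioo 0 Real.pi) := fun θ hθ => by
    simp only
    rw [abs_neg, abs_of_nonneg (h.jac_nonneg (Ioo_subset_Icc_self hθ)), hfG θ hθ]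
  constructor
  · rw [intervalIntegrable_iff_integrableOn_Ioo_of_le h.root_pi_lt_root_zero.le, ← h.image_root,
      integrableOn_image_iff_integrableOn_abs_deriv_smul measurableSet_Ioo hd hinj,
      integrableOn_congr_fun heq measurableSet_Ioo]
    rwa [intervalIntegrable_iff_integrableOn_Ioo_of_le Real.pi_pos.le] at hG
  · rw [intervalIntegral.integral_of_le h.root_pi_lt_root_zero.le,
      intervalIntegral.integral_of_le Real.pi_pos.le, integral_Ioc_eq_integral_Ioo,
      integral_Ioc_eq_integral_Ioo, ← h.image_root,
      integral_image_eq_integral_abs_deriv_smul measurableSet_Ioo hd hinj]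
    exact setIntegral_congr_fun measurableSet_Ioo heq

/-! ### The four branch points -/

/-- `Delta₁` is a difference of squares; its two factors are the quadratics belonging to the angles
`0` and `π`. -/
lemma Stable.Delta₁_eq (h : M.Stable) (y : ℝ) : M.Delta₁ y = (M.mu₂ * M.c₂) ^ 2 *
    ((y - M.root Real.pi) * (y - M.root 0) * (y - M.coRoot 0) * (y - M.coRoot Real.pi)) := by
  have h1 := h.quadratic_eq 0 y
  have h2 := h.quadratic_eq Real.pi y
  have h3 := h.rho_sq
  have e : M.Delta₁ y = (M.mu₂ * M.c₂ * y ^ 2 - M.level 0 * y + M.lam₂) *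
      (M.mu₂ * M.c₂ * y ^ 2 - M.level Real.pi * y + M.lam₂) := by
    rw [Delta₁, level, level, Real.cos_zero, Real.cos_pi]
    linear_combination y ^ 2 * h3
  rw [e, h1, h2]; ring

lemma Stable.Delta₁_eq_zero_iff (h : M.Stable) (y : ℝ) : M.Delta₁ y = 0 ↔
    y = M.root Real.pi ∨ y = M.root 0 ∨ y = M.coRoot 0 ∨ y = M.coRoot Real.pi := by
  have := pow_pos h.up₂_pos 2
  rw [h.Delta₁_eq, mul_eq_zero_iff_left this.ne', mul_eq_zero, mul_eq_zero, mul_eq_zero,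
    sub_eq_zero, sub_eq_zero, sub_eq_zero, sub_eq_zero, or_assoc, or_assoc]

lemma Stable.coRoot_zero_lt_coRoot_pi (h : M.Stable) : M.coRoot 0 < M.coRoot Real.pi := by
  have h1 := h.root_mul_coRoot 0
  have h2 := h.root_mul_coRoot Real.pi
  have h3 := mul_lt_mul_of_pos_left
    (mul_lt_mul_of_pos_right h.root_pi_lt_root_zero (h.coRoot_pos 0)) h.up₂_pos
  have h4 : 0 < M.mu₂ * M.c₂ * M.root Real.pi := mul_pos h.up₂_pos (h.root_pos _)
  nlinarith

/-! ### The angle and the Cauchy density on the circle -/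

/-- The angle `Θ₁` as a function of the angle on the circle. -/
noncomputable def angle (M : Model) (θ : ℝ) : ℝ :=
  Real.arctan (M.root θ * M.rho * Real.sin θ / (2 * M.lam₁ - M.rho * Real.cos θ * M.root θ))

lemma Stable.angle_denom_pos (h : M.Stable) (θ : ℝ) :
    0 < 2 * M.lam₁ - M.rho * Real.cos θ * M.root θ := by
  have h1 := h.rho_lt_two_mul
  have h2 := h.rho_pos
  have h3 := mul_le_mul_of_nonneg_right (Real.cos_le_one θ) (h.root_pos θ).le
  have h4 := (h.root_lt_one_lt_coRoot θ).1
  nlinarith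

lemma Stable.Theta₁_root (h : M.Stable) {θ : ℝ} (hθ : θ ∈ Icc 0 Real.pi) :
    M.Theta₁ (M.root θ) = M.angle θ := by
  have h1 := h.sub_total_mul_root θ
  have e1 : -M.Delta₁ (M.root θ) = (M.root θ * M.rho * Real.sin θ) ^ 2 := by
    rw [Delta₁, h1]
    linear_combination (-M.root θ ^ 2) * h.rho_sq -
      M.root θ ^ 2 * M.rho ^ 2 * Real.sin_sq_add_cos_sq θ
  rw [Theta₁, angle, e1, Real.sqrt_sq (mul_nonneg (mul_nonneg (h.root_pos θ).le h.rho_pos.le)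
    (Real.sin_nonneg_of_mem_Icc hθ))]
  congr 2
  linarith

/-- The square-root singularities of `Theta₁` at the branch points disappear in the coordinate `θ`,
where `√(-Δ₁)` becomes `root θ * rho * sin θ`. -/
lemma Stable.contDiff_angle (h : M.Stable) : ContDiff ℝ 2 M.angle := by
  have h1 := h.contDiff_root
  unfold angle
  exact (ContDiff.div (by fun_prop) (by fun_prop) fun θ => (h.angle_denom_pos θ).ne').arctan

lemma angle_zero : M.angle 0 = 0 := by simp [angle]

lemma angle_pi : M.angle Real.pi = 0 := by simp [angle]

lemma Stable.K_eq (h : M.Stable) (z : ℂ) (θ : ℝ) :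
    (M.root θ : ℂ) * M.K (M.r₁ * z) (M.root θ) =
      M.lam₁ * (M.root θ : ℂ) ^ 2 * (1 - 2 * z * Real.cos θ + z ^ 2) := by
  have h1 := congrArg Complex.ofReal (h.sub_total_mul_root θ)
  have h2 := congrArg Complex.ofReal h.r₁_sq
  have h3 := congrArg Complex.ofReal h.rho_mul_r₁
  rw [K]
  simp only [Complex.ofReal_mul, Complex.ofReal_add, Complex.ofReal_sub, Complex.ofReal_neg,
    Complex.ofReal_pow, Complex.ofReal_ofNat] at h1 h2 h3 ⊢
  linear_combination (M.r₁ * z * M.root θ : ℂ) * h1 + (M.root θ ^ 2 * z ^ 2 : ℂ) * h2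
    - (Real.cos θ * M.root θ ^ 2 * z : ℂ) * h3

lemma Stable.jac_mul (h : M.Stable) (θ : ℝ) :
    M.jac θ * (M.lam₂ - M.mu₂ * M.c₂ * M.root θ ^ 2) = M.rho * Real.sin θ * M.root θ ^ 2 := by
  have h1 := (h.height_deriv_pos θ).ne'
  have h2 := (h.root_pos θ).ne'
  have e : M.lam₂ - M.mu₂ * M.c₂ * M.root θ ^ 2 =
    (M.lam₂ / M.root θ ^ 2 - M.mu₂ * M.c₂) * M.root θ ^ 2 := by field_simp
  rw [jac, e, ← mul_assoc, div_mul_cancel₀ _ h1]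

/-- The Cauchy type density on the cut becomes the Schwarz kernel on the circle. -/
lemma Stable.jac_mul_density (h : M.Stable) {z : ℂ} (hz : ‖z‖ < 1) (θ q : ℝ) :
    M.jac θ * ((((M.lam₂ - M.mu₂ * M.c₂ * M.root θ ^ 2) * q : ℝ) : ℂ) /
      ((M.root θ : ℂ) * M.K (M.r₁ * z) (M.root θ))) =
    q * (M.rho * Real.sin θ / (M.lam₁ * (1 - 2 * z * Real.cos θ + z ^ 2))) := by
  have h1 := congrArg Complex.ofReal (h.jac_mul θ)
  have h2 : (M.root θ : ℂ) ≠ 0 := by exact_mod_cast (h.root_pos θ).ne'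
  have h3 : (M.lam₁ : ℂ) ≠ 0 := by exact_mod_cast h.lam₁_pos.ne'
  have h4 := schwarzKernel_denom_ne_zero hz θ
  rw [h.K_eq]
  generalize (1 - 2 * z * Real.cos θ + z ^ 2) = D at *
  simp only [Complex.ofReal_mul, Complex.ofReal_sub, Complex.ofReal_pow] at h1 ⊢
  field_simp
  linear_combination (q : ℂ) * h1

lemma Stable.mul_density (h : M.Stable) (z : ℂ) (θ : ℝ) :
    (M.r₁ * z : ℂ) * (M.rho * Real.sin θ / (M.lam₁ * (1 - 2 * z * Real.cos θ + z ^ 2))) =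
      schwarzKernel z θ := by
  have h3 : (M.lam₁ : ℂ) ≠ 0 := by exact_mod_cast h.lam₁_pos.ne'
  have h4 := congrArg Complex.ofReal h.rho_mul_r₁
  simp only [Complex.ofReal_mul, Complex.ofReal_ofNat] at h4
  rw [schwarzKernel, mul_div_assoc', show (M.r₁ * z : ℂ) * (M.rho * Real.sin θ) =
    M.lam₁ * (2 * z * Real.sin θ) by linear_combination (z * Real.sin θ : ℂ) * h4,
    mul_div_mul_left _ _ h3]

lemma continuous_density {z : ℂ} (hz : ‖z‖ < 1) (hl : M.lam₁ ≠ 0) : Continuous fun θ : ℝ =>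
    (M.rho * Real.sin θ / (M.lam₁ * (1 - 2 * z * Real.cos θ + z ^ 2)) : ℂ) :=
  Continuous.div (by fun_prop) (by fun_prop) fun θ =>
    mul_ne_zero (by exact_mod_cast hl) (schwarzKernel_denom_ne_zero hz θ)

/-- Only values on the open interval matter: `q` may be badly behaved at the branch points as long
as it agrees inside with a function `G` continuous up to the ends. -/
lemma Stable.integral_density (h : M.Stable) {z : ℂ} (hz : ‖z‖ < 1) {G q : ℝ → ℝ} {f : ℝ → ℂ}
    (hG : ContinuousOn G (Icc 0 Real.pi)) (hq : ∀ θ ∈ Ioo 0 Real.pi, q θ = G θ)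
    (hf : ∀ θ ∈ Ioo 0 Real.pi, f (M.root θ) =
      (((M.lam₂ - M.mu₂ * M.c₂ * M.root θ ^ 2) * q θ : ℝ) : ℂ) /
      ((M.root θ : ℂ) * M.K (M.r₁ * z) (M.root θ))) :
    IntervalIntegrable f volume (M.root Real.pi) (M.root 0) ∧
      (M.r₁ * z : ℂ) * ∫ y in (M.root Real.pi)..(M.root 0), f y =
        ∫ θ in (0 : ℝ)..Real.pi, (G θ : ℂ) * schwarzKernel z θ := by
  have hd := continuous_density (M := M) hz h.lam₁_pos.ne'
  have hGi : IntervalIntegrable (fun θ : ℝ => (G θ : ℂ) *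
      (M.rho * Real.sin θ / (M.lam₁ * (1 - 2 * z * Real.cos θ + z ^ 2)))) volume 0 Real.pi := by
    refine ContinuousOn.intervalIntegrable ?_
    rw [uIcc_of_le Real.pi_pos.le]
    exact (Complex.continuous_ofReal.comp_continuousOn hG).mul hd.continuousOn
  obtain ⟨h1, h2⟩ := h.integral_cut (f := f) hGi fun θ hθ => by
    rw [Complex.real_smul, hf θ hθ, h.jac_mul_density hz, hq θ hθ]
  refine ⟨h1, ?_⟩
  rw [h2, ← intervalIntegral.integral_const_mul]
  refine intervalIntegral.integral_congr fun θ _ => ?_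
  simp only [← h.mul_density z θ]
  ring

/-! ### The principal value `Φ₁` -/

/-- The Cauchy kernel on the cut, in the coordinate `height`. -/
noncomputable def cutKernel (M : Model) (y ξ : ℝ) : ℝ :=
  (M.lam₂ / ξ ^ 2 - M.mu₂ * M.c₂) / (M.height y - M.height ξ)

/-- No condition `ξ ≠ y` is needed: where a denominator vanishes, both sides are `0` by convention.
-/
lemma Phi₁Integrand_eq {y ξ : ℝ} (hy : y ≠ 0) (hξ : ξ ≠ 0) :
    M.Phi₁Integrand y ξ = M.Theta₁ ξ * M.cutKernel y ξ := by
  rw [Phi₁Integrand, cutKernel, height_sub_height hy hξ]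
  generalize M.Theta₁ ξ = T
  have e : M.lam₂ / ξ ^ 2 - M.mu₂ * M.c₂ = (M.lam₂ - M.mu₂ * M.c₂ * ξ ^ 2) / ξ ^ 2 := by
    field_simp
  rw [e]
  rcases eq_or_ne (ξ - y) 0 with h1 | h1
  · simp [h1]
  rcases eq_or_ne (M.mu₂ * M.c₂ * y * ξ - M.lam₂) 0 with h2 | h2
  · simp [h2]
  generalize M.mu₂ * M.c₂ * y * ξ - M.lam₂ = q at *
  generalize ξ - y = d at *
  field_simp

lemma Stable.height_root_ne (h : M.Stable) (θ : ℝ) {ξ : ℝ}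
    (hξ : ξ ∈ Icc (M.root Real.pi) (M.root 0)) (hne : ξ ≠ M.root θ) :
    M.height (M.root θ) - M.height ξ ≠ 0 := by
  obtain ⟨θ', -, rfl⟩ := intermediate_value_Icc' Real.pi_pos.le h.continuous_root.continuousOn hξ
  intro h'
  rcases lt_or_gt_of_ne hne with h1 | h1
  · exact ((h.height_root_lt_iff θ' θ).mpr h1).ne' (sub_eq_zero.mp h')
  · exact ((h.height_root_lt_iff θ θ').mpr h1).ne (sub_eq_zero.mp h')

/-- The kernel is a logarithmic derivative, so it integrates explicitly off the singularity;
`Real.log` of a negative number is the logarithm of its absolute value, which serves both sides of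
the pole. -/
lemma Stable.integral_cutKernel (h : M.Stable) (θ : ℝ) {a b : ℝ} (hab : a ≤ b)
    (ha : M.root Real.pi ≤ a) (hb : b ≤ M.root 0) (hne : M.root θ ∉ Icc a b) :
    IntervalIntegrable (M.cutKernel (M.root θ)) volume a b ∧
    ∫ ξ in a..b, M.cutKernel (M.root θ) ξ =
      Real.log (M.height (M.root θ) - M.height a) - Real.log (M.height (M.root θ) - M.height b) := by
  have hmem : ∀ ξ ∈ uIcc a b, ξ ≠ 0 ∧ M.height (M.root θ) - M.height ξ ≠ 0 := by
    intro ξ hξ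
    rw [uIcc_of_le hab] at hξ
    refine ⟨((h.root_pos _).trans_le (ha.trans hξ.1)).ne', h.height_root_ne θ
      ⟨ha.trans hξ.1, hξ.2.trans hb⟩ ?_⟩
    rintro rfl
    exact hne hξ
  have hcont : ContinuousOn (M.cutKernel (M.root θ)) (uIcc a b) := by
    intro ξ hξ
    obtain ⟨h1, h2⟩ := hmem ξ hξ
    have h3 := (hasDerivAt_height (M := M) h1).continuousAt
    unfold cutKernel
    exact (ContinuousAt.div ((continuousAt_const.div (continuousAt_id.pow 2) (pow_ne_zero 2 h1)).sub
      continuousAt_const) (continuousAt_const.sub h3) h2).continuousWithinAt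
  refine ⟨hcont.intervalIntegrable, ?_⟩
  have hd : ∀ ξ ∈ uIcc a b, HasDerivAt
      (fun ξ => -Real.log (M.height (M.root θ) - M.height ξ)) (M.cutKernel (M.root θ) ξ) ξ := by
    intro ξ hξ
    obtain ⟨h1, h2⟩ := hmem ξ hξ
    refine (((hasDerivAt_height h1).const_sub _).log h2).neg.congr_deriv ?_
    rw [cutKernel, neg_div, neg_neg]
  rw [intervalIntegral.integral_eq_sub_of_hasDerivAt hd hcont.intervalIntegrable]
  ring

/-- The value of the principal value integral `Φ₁` up to the factor `π`. -/
noncomputable def pvValue (M : Model) (θ : ℝ) : ℝ :=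
  (∫ θ' in (0 : ℝ)..Real.pi, hilbertIntegrand M.angle θ θ') +
    M.angle θ * (Real.log (1 + Real.cos θ) - Real.log (1 - Real.cos θ))

lemma Stable.integral_regular (h : M.Stable) {θ : ℝ} (hθ : θ ∈ Ioo 0 Real.pi) :
    IntervalIntegrable (fun ξ => (M.Theta₁ ξ - M.angle θ) * M.cutKernel (M.root θ) ξ) volume
      (M.root Real.pi) (M.root 0) ∧
    ∫ ξ in (M.root Real.pi)..(M.root 0), (M.Theta₁ ξ - M.angle θ) * M.cutKernel (M.root θ) ξ =
      ∫ θ' in (0 : ℝ)..Real.pi, hilbertIntegrand M.angle θ θ' := by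
  refine h.integral_cut (intervalIntegrable_hilbertIntegrand
    (h.contDiff_angle.differentiable (by norm_num)) hθ) fun θ' hθ' => ?_
  have h1 := (h.height_deriv_pos θ').ne'
  have h2 := h.rho_pos.ne'
  rw [h.Theta₁_root (Ioo_subset_Icc_self hθ'), smul_eq_mul, hilbertIntegrand, cutKernel, jac,
    h.height_root, h.height_root, ← mul_sub, mul_left_comm]
  congr 1
  rw [div_mul_div_cancel₀ h1, mul_div_mul_left _ _ h2]

/-- The difference of heights is `ξ - c` times a factor continuous and nonzero at `c`. At `c ± ε`
the contributions `log ε` cancel, which is why symmetric excision converges. -/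
lemma Stable.tendsto_log_sub_log (h : M.Stable) (θ : ℝ) :
    Tendsto (fun ε : ℝ => Real.log (M.height (M.root θ) - M.height (M.root θ + ε)) -
      Real.log (M.height (M.root θ) - M.height (M.root θ - ε))) (𝓝[>] 0) (𝓝 0) := by
  have hc := h.root_pos θ
  have hlt := h.mul_root_mul_root_lt θ θ
  set c := M.root θ with hcdef
  set r : ℝ → ℝ := fun ξ => (M.mu₂ * M.c₂ * c * ξ - M.lam₂) / (c * ξ) with hr
  have hr0 : r c ≠ 0 := div_ne_zero (by rw [mul_assoc]; linarith) (by positivity)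
  have hrc : ContinuousAt r c :=
    ContinuousAt.div (by fun_prop) (by fun_prop) (by positivity)
  have hlog : ContinuousAt (fun ξ => Real.log (r ξ)) c := hrc.log hr0
  have t1 : Tendsto (fun ε : ℝ => c + ε) (𝓝 0) (𝓝 c) := by
    simpa using (continuous_const_add c).tendsto 0
  have t2 : Tendsto (fun ε : ℝ => c - ε) (𝓝 0) (𝓝 c) := by
    simpa using (continuous_sub_left c).tendsto 0
  have hlim := ((hlog.tendsto.comp t1).sub (hlog.tendsto.comp t2)).mono_left
    (nhdsWithin_le_nhds (s := Ioi 0))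
  rw [sub_self] at hlim
  refine hlim.congr' ?_
  have e1 := nhdsWithin_le_nhds (s := Ioi 0) (t1.eventually (hrc.eventually_ne hr0))
  have e2 := nhdsWithin_le_nhds (s := Ioi 0) (t2.eventually (hrc.eventually_ne hr0))
  have e3 := nhdsWithin_le_nhds (s := Ioi 0) (t2.eventually (eventually_ne_nhds hc.ne'))
  filter_upwards [self_mem_nhdsWithin, e1, e2, e3] with ε hε h1 h2 h3
  have hε' : 0 < ε := hε
  have f : ∀ ξ, ξ ≠ 0 → M.height c - M.height ξ = (ξ - c) * r ξ := fun ξ hξ => by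
    rw [height_sub_height hc.ne' hξ, hr, mul_div_assoc]
  simp only [Function.comp_apply]
  rw [f _ (by positivity), f _ h3, Real.log_mul (by simpa using hε'.ne') h1,
    Real.log_mul (by simpa using hε'.ne') h2, add_sub_cancel_left, sub_sub_cancel_left,
    Real.log_neg_eq_log]
  ring

theorem Stable.hasCauchyPV (h : M.Stable) {θ : ℝ} (hθ : θ ∈ Ioo 0 Real.pi) :
    HasCauchyPV (M.Phi₁Integrand (M.root θ)) (M.root Real.pi) (M.root 0) (M.root θ)
      (M.pvValue θ) := by
  obtain ⟨hEi, hEv⟩ := h.integral_regular hθ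
  have hcmem : M.root θ ∈ Ioo (M.root Real.pi) (M.root 0) := by
    rw [← h.image_root]; exact mem_image_of_mem _ hθ
  have hα := h.root_pos Real.pi
  set α := M.root Real.pi with hαdef
  set β := M.root 0 with hβdef
  set c := M.root θ with hcdef
  set E : ℝ → ℝ := fun ξ => (M.Theta₁ ξ - M.angle θ) * M.cutKernel c ξ with hE
  have hev : ∀ᶠ ε in 𝓝[>] (0 : ℝ), 0 < ε ∧ ε < c - α ∧ ε < β - c := by
    have : 0 < min (c - α) (β - c) := lt_min (sub_pos.mpr hcmem.1) (sub_pos.mpr hcmem.2)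
    filter_upwards [Ioo_mem_nhdsGT this] with ε hε
    exact ⟨hε.1, hε.2.trans_le (min_le_left _ _), hε.2.trans_le (min_le_right _ _)⟩
  -- Splitting `Theta₁ ξ` into `Theta₁ ξ - angle θ` and the constant `angle θ` leaves an integrable
  -- part plus an explicit logarithm.
  have hΦ : ∀ a b, α ≤ a → a ≤ b → b ≤ β → EqOn (M.Phi₁Integrand c)
      (fun ξ => E ξ + M.angle θ * M.cutKernel c ξ) (uIcc a b) := by
    intro a b h1 h2 h3 ξ hξ
    rw [uIcc_of_le h2] at hξ
    rw [Phi₁Integrand_eq (h.root_pos θ).ne' (hα.trans_le (h1.trans hξ.1)).ne']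
    simp only [hE]; ring
  have hEab : ∀ a b, α ≤ a → a ≤ b → b ≤ β → IntervalIntegrable E volume a b := by
    intro a b h1 h2 h3
    refine hEi.mono_set ?_
    rw [uIcc_of_le h2, uIcc_of_le (h1.trans (h2.trans h3))]
    exact Icc_subset_Icc h1 h3
  have hpiece : ∀ a b, α ≤ a → a ≤ b → b ≤ β → c ∉ Icc a b →
      IntervalIntegrable (M.Phi₁Integrand c) volume a b ∧
      ∫ ξ in a..b, M.Phi₁Integrand c ξ = (∫ ξ in a..b, E ξ) + M.angle θ *
        (Real.log (M.height c - M.height a) - Real.log (M.height c - M.height b)) := by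
    intro a b h1 h2 h3 h4
    obtain ⟨k1, k2⟩ := h.integral_cutKernel θ h2 h1 h3 h4
    have k3 := hEab a b h1 h2 h3
    constructor
    · exact (k3.add (k1.const_mul _)).congr ((hΦ a b h1 h2 h3).symm.mono uIoc_subset_uIcc)
    · rw [intervalIntegral.integral_congr (hΦ a b h1 h2 h3),
        intervalIntegral.integral_add k3 (k1.const_mul _), intervalIntegral.integral_const_mul, k2]
  have hleft : ∀ ε, 0 < ε → ε < c - α → _ := fun ε h1 h2 =>
    hpiece α (c - ε) le_rfl (by linarith) (by linarith [hcmem.2])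
      (fun hc => by linarith [hc.2])
  have hright : ∀ ε, 0 < ε → ε < β - c → _ := fun ε h1 h2 =>
    hpiece (c + ε) β (by linarith [hcmem.1]) (by linarith) le_rfl
      (fun hc => by linarith [hc.1])
  refine ⟨hev.mono fun ε hε => ⟨(hleft ε hε.1 hε.2.1).1, (hright ε hε.1 hε.2.2).1⟩, ?_⟩
  have hprim : ContinuousOn (fun b => ∫ ξ in α..b, E ξ) (Icc α β) := by
    have := intervalIntegral.continuousOn_primitive_interval' hEi left_mem_uIcc
    rwa [uIcc_of_le (hcmem.1.trans hcmem.2).le] at this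
  have hprimc : ContinuousAt (fun b => ∫ ξ in α..b, E ξ) c :=
    hprim.continuousAt (Icc_mem_nhds hcmem.1 hcmem.2)
  have t1 : Tendsto (fun ε : ℝ => c + ε) (𝓝[>] 0) (𝓝 c) :=
    Tendsto.mono_left (by simpa using (continuous_const_add c).tendsto 0) nhdsWithin_le_nhds
  have t2 : Tendsto (fun ε : ℝ => c - ε) (𝓝[>] 0) (𝓝 c) :=
    Tendsto.mono_left (by simpa using (continuous_sub_left c).tendsto 0) nhdsWithin_le_nhds
  have hlim := (((hprimc.tendsto.comp t2).sub (hprimc.tendsto.comp t1)).add_const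
    ((∫ ξ in α..β, E ξ) + M.angle θ *
      (Real.log (M.height c - M.height α) - Real.log (M.height c - M.height β)))).add
    ((h.tendsto_log_sub_log θ).const_mul (M.angle θ))
  have hval : (∫ ξ in α..c, E ξ) - (∫ ξ in α..c, E ξ) + ((∫ ξ in α..β, E ξ) + M.angle θ *
      (Real.log (M.height c - M.height α) - Real.log (M.height c - M.height β))) +
      M.angle θ * 0 = M.pvValue θ := by
    have hcos : Real.cos θ < 1 := by
      simpa using Real.strictAntiOn_cos (left_mem_Icc.mpr Real.pi_pos.le)
        (Ioo_subset_Icc_self hθ) hθ.1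
    have hcos' : -1 < Real.cos θ := by
      simpa using Real.strictAntiOn_cos (Ioo_subset_Icc_self hθ)
        (right_mem_Icc.mpr Real.pi_pos.le) hθ.2
    rw [hEv, pvValue, hcdef, hαdef, hβdef, h.height_root, h.height_root, h.height_root,
      Real.cos_pi, Real.cos_zero, ← mul_sub, ← mul_sub, Real.log_mul h.rho_pos.ne' (by linarith),
      Real.log_mul h.rho_pos.ne' (by linarith), ← Real.log_neg_eq_log (Real.cos θ - 1),
      neg_sub, sub_neg_eq_add, add_comm (Real.cos θ) 1]
    ring
  rw [hval] at hlim
  refine hlim.congr' ?_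
  filter_upwards [hev] with ε hε
  have e := intervalIntegral.integral_add_adjacent_intervals
    (hEab α (c + ε) le_rfl (by linarith [hcmem.1]) (by linarith))
    (hEab (c + ε) β (by linarith [hcmem.1]) (by linarith) le_rfl)
  rw [(hleft ε hε.1 hε.2.1).2, (hright ε hε.1 hε.2.2).2, ← e]
  simp only [Function.comp_apply]
  ring

lemma Stable.pi_mul_Phi₁ (h : M.Stable) {θ : ℝ} (hθ : θ ∈ Ioo 0 Real.pi) :
    Real.pi * M.Phi₁ (M.root Real.pi) (M.root 0) (M.root θ) = M.pvValue θ := by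
  rw [Phi₁, cauchyPV, (h.hasCauchyPV hθ).2.limUnder_eq]
  field_simp

lemma Stable.sineSeries_angle_exp (h : M.Stable) {θ : ℝ} (hθ : θ ∈ Ioo 0 Real.pi) :
    sineSeries M.angle (Complex.exp (θ * Complex.I)) =
      (M.Phi₁ (M.root Real.pi) (M.root 0) (M.root θ) : ℂ) + M.angle θ * Complex.I := by
  rw [sineSeries_exp_mul_I h.contDiff_angle angle_zero angle_pi hθ, ← pvValue,
    ← h.pi_mul_Phi₁ hθ, one_div, inv_mul_cancel_left₀ Real.pi_ne_zero]

/-! ### The generator of the walk and stationarity -/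

/-- The sum `∑ m, rate n m • f m`. -/
noncomputable def inflow (M : Model) {E : Type*} [AddCommMonoid E] [Module ℝ E] (f : State → E)
    (n : State) : E :=
  (M.mu₁ * M.c₁) • f (n.1 + 1, n.2) + (M.mu₂ * M.c₂) • f (n.1, n.2 + 1) +
    (if 0 < n.1 then M.lam₁ • f (n.1 - 1, n.2) else 0) +
    (if 0 < n.2 then (M.lam₂ + if n.1 = 0 ∧ M.a < n.2 then M.lam₁ else 0) • f (n.1, n.2 - 1) else 0)

/-- The generator of the walk applied to `f`. -/
noncomputable def drift (M : Model) {E : Type*} [AddCommGroup E] [Module ℝ E] (f : State → E)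
    (n : State) : E :=
  M.inflow f n - M.inflow (fun _ => (1 : ℝ)) n • f n

lemma rate_eq (n m : State) : M.rate n m =
    (if m = (n.1 + 1, n.2) then M.mu₁ * M.c₁ else 0) +
    (if m = (n.1, n.2 + 1) then M.mu₂ * M.c₂ else 0) +
    (if m = (n.1 - 1, n.2) ∧ 0 < n.1 then M.lam₁ else 0) +
    (if m = (n.1, n.2 - 1) ∧ 0 < n.2 then
      M.lam₂ + if n.1 = 0 ∧ M.a < n.2 then M.lam₁ else 0 else 0) := by
  obtain ⟨n₁, n₂⟩ := n
  obtain ⟨m₁, m₂⟩ := m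
  unfold rate
  simp only [Prod.mk.injEq]
  generalize (M.lam₂ + if n₁ = 0 ∧ M.a < n₂ then M.lam₁ else 0) = q
  split_ifs <;> first | omega | ring

lemma hasSum_ite_and_smul {E : Type*} [AddCommMonoid E] [Module ℝ E] [TopologicalSpace E]
    (f : State → E) (k : State) (P : Prop) [Decidable P] (c : ℝ) :
    HasSum (fun m => (if m = k ∧ P then c else 0) • f m) (if P then c • f k else 0) := by
  by_cases hP : P
  · simp only [hP, and_true, if_true]
    convert hasSum_ite_eq k (c • f k) using 2 with m
    split_ifs with h
    · rw [h]
    · rw [zero_smul]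
  · simp only [hP, and_false, if_false, zero_smul]
    exact hasSum_zero

lemma hasSum_rate_smul {E : Type*} [NormedAddCommGroup E] [NormedSpace ℝ E] (f : State → E)
    (n : State) : HasSum (fun m => M.rate n m • f m) (M.inflow f n) := by
  have h1 := hasSum_ite_and_smul f (n.1 + 1, n.2) True (M.mu₁ * M.c₁)
  have h2 := hasSum_ite_and_smul f (n.1, n.2 + 1) True (M.mu₂ * M.c₂)
  have h3 := hasSum_ite_and_smul f (n.1 - 1, n.2) (0 < n.1) M.lam₁
  have h4 := hasSum_ite_and_smul f (n.1, n.2 - 1) (0 < n.2)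
    (M.lam₂ + if n.1 = 0 ∧ M.a < n.2 then M.lam₁ else 0)
  simp only [and_true, if_true] at h1 h2
  refine (((h1.add h2).add h3).add h4).congr_fun fun m => ?_
  rw [rate_eq, add_smul, add_smul, add_smul]

lemma tsum_rate (n : State) : ∑' m, M.rate n m = M.inflow (fun _ => (1 : ℝ)) n := by
  rw [← (hasSum_rate_smul (fun _ => (1 : ℝ)) n).tsum_eq]
  simp

lemma Stable.rate_nonneg (h : M.Stable) (n m : State) : 0 ≤ M.rate n m := by
  have h1 := h.lam₁_pos.le
  have h2 := h.lam₂_pos.le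
  have h3 := h.up₁_pos.le
  have h4 := h.up₂_pos.le
  unfold rate
  split_ifs <;> linarith

lemma Stable.inflow_mono (h : M.Stable) {f g : State → ℝ} (hfg : ∀ n, f n ≤ g n) (n : State) :
    M.inflow f n ≤ M.inflow g n :=
  hasSum_le (fun m => smul_le_smul_of_nonneg_left (hfg m) (h.rate_nonneg n m))
    (hasSum_rate_smul f n) (hasSum_rate_smul g n)

lemma inflow_const (c : ℝ) (n : State) :
    M.inflow (fun _ => c) n = M.inflow (fun _ => (1 : ℝ)) n * c := by
  have h1 := (hasSum_rate_smul (M := M) (fun _ => (1 : ℝ)) n).mul_right c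
  refine (hasSum_rate_smul (fun _ => c) n).unique (h1.congr_fun fun m => ?_)
  simp

lemma Stable.inflow_one_le (h : M.Stable) (n : State) :
    M.inflow (fun _ => (1 : ℝ)) n ≤ M.total + M.lam₁ := by
  have h1 := h.lam₁_pos.le
  have h2 := h.lam₂_pos.le
  simp only [inflow, smul_eq_mul, mul_one, total]
  split_ifs <;> linarith

lemma Stable.inflow_nonneg (h : M.Stable) {f : State → ℝ} (hf : ∀ n, 0 ≤ f n) (n : State) :
    0 ≤ M.inflow f n :=
  (hasSum_rate_smul f n).nonneg fun m => smul_nonneg (h.rate_nonneg n m) (hf m)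

/-- The stationary expectation of the generator applied to an integrable function vanishes. -/
theorem Stable.hasSum_drift (h : M.Stable) {p : State → ℝ}
    (hp : IsStationaryDistribution M.rate p) {E : Type*} [NormedAddCommGroup E] [NormedSpace ℝ E]
    [CompleteSpace E] {f : State → E}
    (hf : Summable fun n => p n * M.inflow (fun m => ‖f m‖) n) :
    HasSum (fun n => p n • M.drift f n) 0 := by
  -- The family `p n * rate n m * f m` is absolutely summable. Summed by rows it gives the mean of
  -- `inflow f`; summed by columns, by global balance, the mean of the total exit rate times `f`.
  have hs : Summable fun x : State × State => (p x.1 * M.rate x.1 x.2) • f x.2 := by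
    apply Summable.of_norm
    have hrow : ∀ n, HasSum (fun m => ‖(p n * M.rate n m) • f m‖)
        (p n * M.inflow (fun m => ‖f m‖) n) := by
      intro n
      refine ((hasSum_rate_smul (fun m => ‖f m‖) n).mul_left (p n)).congr_fun fun m => ?_
      rw [norm_smul, Real.norm_of_nonneg (mul_nonneg (hp.nonneg n) (h.rate_nonneg n m)),
        smul_eq_mul, mul_assoc]
    rw [summable_prod_of_nonneg fun x => norm_nonneg _]
    exact ⟨fun n => (hrow n).summable, hf.congr fun n => (hrow n).tsum_eq.symm⟩
  have h1 := hs.hasSum.prod_fiberwise fun n =>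
    ((hasSum_rate_smul (M := M) f n).const_smul (p n)).congr_fun fun m => mul_smul _ _ _
  have h2 := ((Equiv.prodComm State State).hasSum_iff.mpr hs.hasSum).prod_fiberwise fun m =>
    (hp.balance m).smul_const (f m)
  have h3 := h1.sub h2
  rw [sub_self] at h3
  refine h3.congr_fun fun n => ?_
  rw [drift, smul_sub, tsum_rate, mul_smul]

/-! ### Exponential moments -/

/-- The generator applied to a geometric function `x ^ n₁ * y ^ n₂`. -/
lemma drift_geometric {𝕜 : Type*} [Field 𝕜] [Algebra ℝ 𝕜] {x y : 𝕜} (hx : x ≠ 0) (hy : y ≠ 0)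
    (n : State) : M.drift (fun n : State => x ^ n.1 * y ^ n.2) n =
      ((M.mu₁ * M.c₁) • (x - 1) + (M.mu₂ * M.c₂) • (y - 1) + M.lam₁ • (1 / x - 1) +
        M.lam₂ • (1 / y - 1)) * (x ^ n.1 * y ^ n.2) +
      (if n.1 = 0 then M.lam₁ • (1 - 1 / x) * y ^ n.2 else 0) +
      (if n.2 = 0 then M.lam₂ • (1 - 1 / y) * x ^ n.1 else 0) +
      (if n.1 = 0 ∧ M.a < n.2 then M.lam₁ • (1 / y - 1) * y ^ n.2 else 0) := by
  obtain ⟨n₁, n₂⟩ := n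
  simp only [drift, inflow, Algebra.smul_def, mul_one]
  generalize M.mu₁ * M.c₁ = A
  generalize M.mu₂ * M.c₂ = B
  rcases n₁ with _ | n₁ <;> rcases n₂ with _ | n₂
  · simp
    field_simp
    ring
  · by_cases h : M.a < n₂ + 1
    · simp [h]
      field_simp
      ring
    · simp [h]
      field_simp
      ring
  · simp
    field_simp
    ring
  · simp
    field_simp
    ring

lemma Stable.inflow_geometric_le (h : M.Stable) {x y : ℝ} (hx : 0 < x) (hy : 0 < y) (n : State) :
    M.inflow (fun n : State => x ^ n.1 * y ^ n.2) n ≤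
      (M.mu₁ * M.c₁ * x + M.mu₂ * M.c₂ * y + M.lam₁ / x + (M.lam₂ + M.lam₁) / y) *
        (x ^ n.1 * y ^ n.2) := by
  obtain ⟨n₁, n₂⟩ := n
  have h1 := h.lam₁_pos
  have h2 := h.lam₂_pos
  have e3 : (if 0 < n₁ then M.lam₁ * (x ^ (n₁ - 1) * y ^ n₂) else 0) ≤
      M.lam₁ / x * (x ^ n₁ * y ^ n₂) := by
    rcases n₁ with _ | n₁
    · simp only [lt_irrefl, if_false]; positivity
    · rw [if_pos n₁.succ_pos, Nat.add_sub_cancel, pow_succ]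
      apply le_of_eq
      field_simp
  have e4 : (if 0 < n₂ then (M.lam₂ + if n₁ = 0 ∧ M.a < n₂ then M.lam₁ else 0) *
      (x ^ n₁ * y ^ (n₂ - 1)) else 0) ≤ (M.lam₂ + M.lam₁) / y * (x ^ n₁ * y ^ n₂) := by
    rcases n₂ with _ | n₂
    · simp only [lt_irrefl, if_false]; positivity
    · rw [if_pos n₂.succ_pos, Nat.add_sub_cancel, pow_succ]
      have : (M.lam₂ + if n₁ = 0 ∧ M.a < n₂ + 1 then M.lam₁ else 0) ≤ M.lam₂ + M.lam₁ := by
        split_ifs <;> linarith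
      calc _ ≤ (M.lam₂ + M.lam₁) * (x ^ n₁ * y ^ n₂) := by gcongr
        _ = _ := by field_simp
  simp only [inflow, smul_eq_mul]
  rw [add_mul _ ((M.lam₂ + M.lam₁) / y), add_mul _ (M.lam₁ / x)]
  refine add_le_add (add_le_add (le_of_eq ?_) e3) e4
  ring

/-- A Lyapunov criterion: exponential moments at which the drift in the interior is negative and
which decrease in the second coordinate are finite. -/
theorem Stable.summable_geometric (h : M.Stable) {p : State → ℝ}
    (hp : IsStationaryDistribution M.rate p) {x y : ℝ} (hx : 1 ≤ x) (hy : 0 < y) (hy1 : y < 1)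
    (hκ : M.mu₁ * M.c₁ * (x - 1) + M.mu₂ * M.c₂ * (y - 1) + M.lam₁ * (1 / x - 1) +
        M.lam₂ * (1 / y - 1) < 0) :
    Summable fun n : State => p n * (x ^ n.1 * y ^ n.2) := by
  set κ := M.mu₁ * M.c₁ * (x - 1) + M.mu₂ * M.c₂ * (y - 1) + M.lam₁ * (1 / x - 1) +
        M.lam₂ * (1 / y - 1) with hκdef
  have hx0 : 0 < x := by linarith
  have hl1 := h.lam₁_pos
  have hl2 := h.lam₂_pos
  have hxi : 0 ≤ 1 - 1 / x := by
    rw [sub_nonneg, div_le_one hx0]; exact hx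
  have hyi : 0 ≤ 1 / y - 1 := by
    rw [sub_nonneg, le_div_iff₀ hy]; linarith
  set f : State → ℝ := fun n => x ^ n.1 * y ^ n.2 with hf
  have hf0 : ∀ n, 0 ≤ f n := fun n => by simp only [hf]; positivity
  set C := M.lam₁ * (1 - 1 / x) + M.lam₁ * (1 / y - 1) with hC
  have hC0 : 0 ≤ C := by positivity
  have hdrift : ∀ n, M.drift f n ≤ κ * f n + C := by
    intro n
    have hyn : y ^ n.2 ≤ 1 := pow_le_one₀ hy.le hy1.le
    rw [hf, drift_geometric hx0.ne' hy.ne']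
    simp only [smul_eq_mul]
    have a1 : (if n.1 = 0 then M.lam₁ * (1 - 1 / x) * y ^ n.2 else 0) ≤ M.lam₁ * (1 - 1 / x) := by
      split_ifs
      · exact mul_le_of_le_one_right (by positivity) hyn
      · positivity
    -- The only boundary term that grows, through `x ^ n.1`, has a favourable sign because `y < 1`.
    have a2 : (if n.2 = 0 then M.lam₂ * (1 - 1 / y) * x ^ n.1 else 0) ≤ 0 := by
      split_ifs
      · exact mul_nonpos_of_nonpos_of_nonneg
          (mul_nonpos_of_nonneg_of_nonpos hl2.le (by linarith)) (by positivity)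
      · exact le_rfl
    have a3 : (if n.1 = 0 ∧ M.a < n.2 then M.lam₁ * (1 / y - 1) * y ^ n.2 else 0) ≤
        M.lam₁ * (1 / y - 1) := by
      split_ifs
      · exact mul_le_of_le_one_right (by positivity) hyn
      · positivity
    linarith
  refine summable_of_sum_le (c := C / -κ) (fun n => mul_nonneg (hp.nonneg n) (hf0 n)) fun S => ?_
  -- This truncation level makes `g = min f N` bounded, so that its drift has mean zero, while `g =
  -- f` on `S`.
  set N := ∑ n ∈ S, f n with hN
  have hSN : ∀ n ∈ S, f n ≤ N := fun n hn => Finset.single_le_sum (fun m _ => hf0 m) hn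
  have hN0 : 0 ≤ N := Finset.sum_nonneg fun m _ => hf0 m
  set g : State → ℝ := fun n => min (f n) N with hg
  have hg0 : ∀ n, 0 ≤ g n := fun n => le_min (hf0 n) hN0
  have hgd : ∀ n, M.drift g n ≤ C := by
    intro n
    rcases le_or_gt (f n) N with hn | hn
    · have h1 := h.inflow_mono (fun m => min_le_left (f m) N) n
      have h2 := hdrift n
      have h3 : κ * f n ≤ 0 := mul_nonpos_of_nonpos_of_nonneg hκ.le (hf0 n)
      have h4 : g n = f n := min_eq_left hn
      rw [drift] at h2 ⊢
      rw [h4]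
      linarith
    · have h1 := h.inflow_mono (fun m => min_le_right (f m) N) n
      have h4 : g n = N := min_eq_right hn.le
      rw [inflow_const] at h1
      rw [drift, h4, smul_eq_mul]
      linarith
  have hgS : ∀ n ∈ S, M.drift g n ≤ κ * f n + C := by
    intro n hn
    have h1 := h.inflow_mono (fun m => min_le_left (f m) N) n
    have h4 : g n = f n := min_eq_left (hSN n hn)
    refine le_trans ?_ (hdrift n)
    rw [drift, drift, h4]
    linarith
  have hsum : HasSum (fun n => p n • M.drift g n) 0 := by
    refine h.hasSum_drift hp ?_
    refine Summable.of_nonneg_of_le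
      (fun n => mul_nonneg (hp.nonneg n) (h.inflow_nonneg (fun m => norm_nonneg _) n))
      (fun n => ?_) (hp.hasSum_one.summable.mul_right ((M.total + M.lam₁) * N))
    refine mul_le_mul_of_nonneg_left ?_ (hp.nonneg n)
    have h1 := h.inflow_mono (f := fun m => ‖g m‖) (g := fun _ => N) (fun m => by
      rw [Real.norm_of_nonneg (hg0 m)]; exact min_le_right _ _) n
    rw [inflow_const] at h1
    exact h1.trans (mul_le_mul_of_nonneg_right (h.inflow_one_le n) hN0)
  have hsum2 := (hp.hasSum_one.mul_right C).sub hsum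
  rw [one_mul, sub_zero] at hsum2
  -- The nonnegative terms `p * (C - drift g)` sum to `C` and are at least `-κ * p * f` on `S`,
  -- which bounds the partial sum by `C / -κ`.
  have hle := sum_le_hasSum S (fun n _ => by
    rw [smul_eq_mul, ← mul_sub]
    exact mul_nonneg (hp.nonneg n) (sub_nonneg.mpr (hgd n))) hsum2
  rw [le_div_iff₀ (neg_pos.mpr hκ), Finset.sum_mul]
  refine le_trans (Finset.sum_le_sum fun n hn => ?_) hle
  have := mul_le_mul_of_nonneg_left (hgS n hn) (hp.nonneg n)
  rw [smul_eq_mul]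
  linarith

/-! ### The functional equation -/

lemma hasSum_ite_fst_eq_zero {E : Type*} [AddCommMonoid E] [TopologicalSpace E] (P : ℕ → Prop)
    [DecidablePred P] {f : State → E} {s : E}
    (hf : HasSum (fun k : ℕ => if P k then f (0, k) else 0) s) :
    HasSum (fun n : State => if n.1 = 0 ∧ P n.2 then f n else 0) s := by
  have hinj : Function.Injective fun k : ℕ => ((0, k) : State) := fun a b hab => by simpa using hab
  refine (hinj.hasSum_iff ?_).mp (hf.congr_fun fun k => by simp)
  rintro ⟨n₁, n₂⟩ hn
  rw [if_neg]
  rintro ⟨h1, -⟩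
  exact hn ⟨n₂, by simp [← h1]⟩

lemma hasSum_ite_snd_eq_zero {E : Type*} [AddCommMonoid E] [TopologicalSpace E]
    {f : State → E} {s : E} (hf : HasSum (fun k : ℕ => f (k, 0)) s) :
    HasSum (fun n : State => if n.2 = 0 then f n else 0) s := by
  have hinj : Function.Injective fun k : ℕ => ((k, 0) : State) := fun a b hab => by simpa using hab
  refine (hinj.hasSum_iff ?_).mp (hf.congr_fun fun k => by simp)
  rintro ⟨n₁, n₂⟩ hn
  rw [if_neg]
  rintro (h1 : n₂ = 0)
  exact hn ⟨n₁, by simp [← h1]⟩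

/-- The functional equation of the generating functions on the zero set of the kernel. -/
theorem Stable.functional_equation (h : M.Stable) {p : State → ℝ}
    (hp : IsStationaryDistribution M.rate p) {x y : ℂ} (hx : x ≠ 0) (hy : y ≠ 0)
    (hs : Summable fun n : State => p n * (‖x‖ ^ n.1 * ‖y‖ ^ n.2)) (hK : M.K x y = 0) :
    M.lam₁ * (1 - 1 / x) * ∑' k, (p (0, k) : ℂ) * y ^ k + M.lam₂ * (1 - 1 / y) * genP₁ p x +
      M.lam₁ * (1 / y - 1) * ((∑' k, (p (0, k) : ℂ) * y ^ k) -
        ∑ k ∈ Finset.range (M.a + 1), (p (0, k) : ℂ) * y ^ k) = 0 := by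
  have hx' : 0 < ‖x‖ := norm_pos_iff.mpr hx
  have hy' : 0 < ‖y‖ := norm_pos_iff.mpr hy
  have hd : HasSum (fun n => p n • M.drift (fun n : State => x ^ n.1 * y ^ n.2) n) 0 := by
    refine h.hasSum_drift hp ?_
    simp only [norm_mul, norm_pow]
    refine Summable.of_nonneg_of_le
      (fun n => mul_nonneg (hp.nonneg n) (h.inflow_nonneg (fun m => by positivity) n))
      (fun n => ?_) (hs.mul_left (M.mu₁ * M.c₁ * ‖x‖ + M.mu₂ * M.c₂ * ‖y‖ + M.lam₁ / ‖x‖ +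
        (M.lam₂ + M.lam₁) / ‖y‖))
    rw [mul_left_comm]
    exact mul_le_mul_of_nonneg_left (h.inflow_geometric_le hx' hy' n) (hp.nonneg n)
  have hs0 : Summable fun k : ℕ => (p (0, k) : ℂ) * y ^ k := by
    apply Summable.of_norm
    refine (hs.comp_injective (i := fun k : ℕ => ((0, k) : State))
      fun a b hab => by simpa using hab).congr fun k => ?_
    rw [norm_mul, norm_pow, Complex.norm_real, Real.norm_of_nonneg (hp.nonneg _)]
    simp
  have hs1 : Summable fun k : ℕ => (p (k, 0) : ℂ) * x ^ k := by
    apply Summable.of_norm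
    refine (hs.comp_injective (i := fun k : ℕ => ((k, 0) : State))
      fun a b hab => by simpa using hab).congr fun k => ?_
    rw [norm_mul, norm_pow, Complex.norm_real, Real.norm_of_nonneg (hp.nonneg _)]
    simp
  -- The interior symbol of the generator is `K x y / (x * y)`, so it vanishes here and only
  -- boundary terms remain.
  have hκ : (M.mu₁ * M.c₁) • (x - 1) + (M.mu₂ * M.c₂) • (y - 1) + M.lam₁ • (1 / x - 1) +
      M.lam₂ • (1 / y - 1) = 0 := by
    have e : x * y * ((M.mu₁ * M.c₁) • (x - 1) + (M.mu₂ * M.c₂) • (y - 1) + M.lam₁ • (1 / x - 1) +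
      M.lam₂ • (1 / y - 1)) = M.K x y := by
      simp only [K, total, Complex.real_smul]
      push_cast
      field_simp
      ring
    rw [hK] at e
    exact (mul_eq_zero_iff_left (mul_ne_zero hx hy)).mp e
  have hplus : HasSum (fun k : ℕ => if M.a < k then (p (0, k) : ℂ) * y ^ k else 0)
      ((∑' k, (p (0, k) : ℂ) * y ^ k) -
        ∑ k ∈ Finset.range (M.a + 1), (p (0, k) : ℂ) * y ^ k) := by
    have h2 : HasSum (fun k : ℕ => if M.a < k then 0 else (p (0, k) : ℂ) * y ^ k)
        (∑ k ∈ Finset.range (M.a + 1), if M.a < k then 0 else (p (0, k) : ℂ) * y ^ k) :=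
      hasSum_sum_of_ne_finset_zero fun k hk => if_pos (by
        rw [Finset.mem_range] at hk; omega)
    rw [Finset.sum_congr rfl fun k hk => if_neg (by rw [Finset.mem_range] at hk; omega)] at h2
    refine (hs0.hasSum.sub h2).congr_fun fun k => ?_
    split_ifs <;> simp
  have t1 := hasSum_ite_fst_eq_zero (fun _ => True)
    (f := fun n : State => (p n : ℂ) * y ^ n.2) (by simpa using hs0.hasSum)
  have t2 := hasSum_ite_snd_eq_zero (f := fun n : State => (p n : ℂ) * x ^ n.1) hs1.hasSum
  have t3 := hasSum_ite_fst_eq_zero (fun k => M.a < k)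
    (f := fun n : State => (p n : ℂ) * y ^ n.2) hplus
  have t := ((t1.mul_left (M.lam₁ * (1 - 1 / x) : ℂ)).add
    (t2.mul_left (M.lam₂ * (1 - 1 / y) : ℂ))).add (t3.mul_left (M.lam₁ * (1 / y - 1) : ℂ))
  refine (t.unique (hd.congr_fun fun n => ?_))
  rw [drift_geometric hx hy, hκ, zero_mul, zero_add]
  simp only [Complex.real_smul, and_true]
  split_ifs <;> ring

/-! ### The boundary condition on the circle of radius `r₁` -/

/-- Finite exponential moments on the circle of radius `r₁`. -/
lemma Stable.summable_r₁ (h : M.Stable) {p : State → ℝ}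
    (hp : IsStationaryDistribution M.rate p) :
    Summable fun n : State => p n * (M.r₁ ^ n.1 * ((M.root 0 + 1) / 2) ^ n.2) := by
  obtain ⟨h1, h2⟩ := h.root_lt_one_lt_coRoot 0
  have h3 := h.root_pos 0
  have h4 := h.r₁_pos
  -- At `root 0` the interior drift is exactly zero. Any point strictly between `root 0` and `1`
  -- makes it negative, and dominates every `root θ`.
  set y := (M.root 0 + 1) / 2 with hy
  have hy0 : 0 < y := by positivity
  refine h.summable_geometric hp h.one_lt_r₁.le hy0 (by linarith) ?_
  have e : (M.mu₁ * M.c₁ * (M.r₁ - 1) + M.mu₂ * M.c₂ * (y - 1) + M.lam₁ * (1 / M.r₁ - 1) +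
        M.lam₂ * (1 / y - 1)) * y = M.mu₂ * M.c₂ * ((y - M.root 0) * (y - M.coRoot 0)) := by
    rw [← h.quadratic_eq 0 y, level, Real.cos_zero, h.rho_eq, total]
    have hl : M.lam₁ * (1 / M.r₁) = M.mu₁ * M.c₁ * M.r₁ := by
      rw [← h.r₁_sq]; field_simp
    have hy' : M.lam₂ * (1 / y) * y = M.lam₂ := by field_simp
    linear_combination y * hl + hy'
  have hneg : M.mu₂ * M.c₂ * ((y - M.root 0) * (y - M.coRoot 0)) < 0 :=
    mul_neg_of_pos_of_neg h.up₂_pos (mul_neg_of_pos_of_neg (by linarith) (by linarith))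
  rw [← e] at hneg
  exact neg_of_mul_neg_left hneg hy0.le

lemma Stable.root_le_root_zero (h : M.Stable) (θ : ℝ) : M.root θ ≤ M.root 0 := by
  by_contra hc
  push Not at hc
  rw [← h.height_root_lt_iff, h.height_root, h.height_root, Real.cos_zero] at hc
  nlinarith [Real.cos_le_one θ, h.rho_pos]

/-- On the circle of radius `r₁`, the function `λ₂ P₁ + λ₁ P₂⁻` has argument `Θ₁`
up to a real factor. -/
theorem Stable.boundary_equation (h : M.Stable) {p : State → ℝ}
    (hp : IsStationaryDistribution M.rate p) (θ : ℝ) :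
    ∃ R : ℝ, M.lam₂ * genP₁ p (M.r₁ * Complex.exp (θ * Complex.I)) +
      M.lam₁ * (polyP₂minus M.a p (M.root θ) : ℂ) = R * Complex.exp (M.angle θ * Complex.I) := by
  have hr := h.r₁_pos
  have hy := h.root_pos θ
  have hy1 := (h.root_lt_one_lt_coRoot θ).1
  have hr' : (M.r₁ : ℂ) ≠ 0 := by exact_mod_cast hr.ne'
  have hy' : (M.root θ : ℂ) ≠ 0 := by exact_mod_cast hy.ne'
  have hx : (M.r₁ * Complex.exp (θ * Complex.I) : ℂ) ≠ 0 := mul_ne_zero hr' (Complex.exp_ne_zero _)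
  have hxn : ‖(M.r₁ * Complex.exp (θ * Complex.I) : ℂ)‖ = M.r₁ := by
    rw [norm_mul, Complex.norm_exp_ofReal_mul_I, mul_one, Complex.norm_real,
      Real.norm_of_nonneg hr.le]
  have hyn : ‖(M.root θ : ℂ)‖ = M.root θ := by
    rw [Complex.norm_real, Real.norm_of_nonneg hy.le]
  have hK : M.K (M.r₁ * Complex.exp (θ * Complex.I)) (M.root θ) = 0 := by
    have := h.K_eq (Complex.exp (θ * Complex.I)) θ
    rw [schwarzKernel_denom_exp, sub_self, mul_zero, Complex.ofReal_zero, mul_zero, mul_zero] at this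
    exact (mul_eq_zero_iff_left hy').mp this
  have hs : Summable fun n : State => p n * (‖(M.r₁ * Complex.exp (θ * Complex.I) : ℂ)‖ ^ n.1 *
      ‖(M.root θ : ℂ)‖ ^ n.2) := by
    rw [hxn, hyn]
    refine Summable.of_nonneg_of_le (fun n => mul_nonneg (hp.nonneg n) (by positivity))
      (fun n => mul_le_mul_of_nonneg_left ?_ (hp.nonneg n)) (h.summable_r₁ hp)
    have : M.root θ ≤ (M.root 0 + 1) / 2 := by
      linarith [h.root_le_root_zero θ, (h.root_lt_one_lt_coRoot 0).1]
    gcongr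
  have hfe := h.functional_equation hp hx hy' hs hK
  have e1 : ∑' k, (p (0, k) : ℂ) * (M.root θ : ℂ) ^ k =
      ((∑' k, p (0, k) * M.root θ ^ k : ℝ) : ℂ) := by
    rw [Complex.ofReal_tsum]; push_cast; rfl
  have e2 : ∑ k ∈ Finset.range (M.a + 1), (p (0, k) : ℂ) * (M.root θ : ℂ) ^ k =
      (polyP₂minus M.a p (M.root θ) : ℂ) := by
    rw [polyP₂minus]; push_cast; rfl
  rw [e1, e2] at hfe
  have hcos := Real.cos_arctan_pos (M.root θ * M.rho * Real.sin θ /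
    (2 * M.lam₁ - M.rho * Real.cos θ * M.root θ))
  rw [← angle] at hcos
  have hD := h.angle_denom_pos θ
  have hl := h.lam₁_pos
  have hl' : (M.lam₁ : ℂ) ≠ 0 := by exact_mod_cast hl.ne'
  have htan : Real.sin (M.angle θ) * (2 * M.lam₁ - M.rho * Real.cos θ * M.root θ) =
      M.root θ * M.rho * Real.sin θ * Real.cos (M.angle θ) := by
    have h1 : Real.tan (M.angle θ) = _ := Real.tan_arctan _
    rw [Real.tan_eq_sin_div_cos, div_eq_div_iff hcos.ne' hD.ne'] at h1
    exact h1
  -- Since `1 / r₁ = rho / (2 λ₁)`, the number `1 - y / x` is `1 / (2 λ₁)` times a complex number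
  -- with real and imaginary parts the denominator and numerator in `angle`. The denominator is
  -- positive, so the arctangent is the true argument.
  have hone : (1 - M.root θ * (M.r₁ * Complex.exp (θ * Complex.I))⁻¹ : ℂ) =
      (((2 * M.lam₁ - M.rho * Real.cos θ * M.root θ) / (2 * M.lam₁ * Real.cos (M.angle θ)) : ℝ)
        : ℂ) * Complex.exp (M.angle θ * Complex.I) := by
    have hc' : (Real.cos (M.angle θ) : ℂ) ≠ 0 := by exact_mod_cast hcos.ne'
    have h1 : (2 * M.lam₁ : ℂ) = M.rho * M.r₁ := by exact_mod_cast h.rho_mul_r₁.symm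
    have h2 : (M.r₁ * Complex.exp (θ * Complex.I) : ℂ)⁻¹ =
        (M.r₁ : ℂ)⁻¹ * (Real.cos θ - Real.sin θ * Complex.I) := by
      rw [mul_inv, ← Complex.exp_neg, ← neg_mul, Complex.exp_mul_I, Complex.cos_neg,
        Complex.sin_neg, ← Complex.ofReal_cos, ← Complex.ofReal_sin]
      ring
    have h3 : (M.rho : ℂ) = 2 * M.lam₁ * (M.r₁ : ℂ)⁻¹ := by rw [h1]; field_simp
    have h4 := congrArg Complex.ofReal htan
    rw [h2, Complex.exp_mul_I, ← Complex.ofReal_cos (M.angle θ), ← Complex.ofReal_sin (M.angle θ)]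
    simp only [Complex.ofReal_mul, Complex.ofReal_sub, Complex.ofReal_div,
      Complex.ofReal_ofNat] at h4 ⊢
    rw [div_mul_eq_mul_div, eq_div_iff (mul_ne_zero (mul_ne_zero two_ne_zero hl') hc')]
    linear_combination -Complex.I * h4 + Real.cos (M.angle θ) * M.root θ *
      (Real.cos θ - Real.sin θ * Complex.I) * h3
  have hyi : (1 / M.root θ - 1 : ℂ) ≠ 0 := by
    have : (0 : ℝ) < 1 / M.root θ - 1 := by
      rw [sub_pos, lt_div_iff₀ hy]; linarith
    exact_mod_cast this.ne'
  -- With `T = ∑ p(0, k) y ^ k`, the functional equation reads `(1 / y - 1) (λ₂ P₁ + λ₁ P₂⁻) = λ₁ T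
  -- (1 - y / x) / y`; this is the real factor it yields.
  refine ⟨M.lam₁ / (M.root θ * (1 / M.root θ - 1)) * (∑' k, p (0, k) * M.root θ ^ k) *
    ((2 * M.lam₁ - M.rho * Real.cos θ * M.root θ) / (2 * M.lam₁ * Real.cos (M.angle θ))), ?_⟩
  rw [Complex.ofReal_mul, mul_assoc, ← hone]
  push_cast
  rw [one_div (M.r₁ * Complex.exp (θ * Complex.I) : ℂ)] at hfe
  generalize (M.r₁ * Complex.exp (θ * Complex.I) : ℂ)⁻¹ = w at hfe ⊢
  apply mul_left_cancel₀ hyi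
  rw [show ∀ P Q : ℂ, (1 / M.root θ - 1 : ℂ) * (M.lam₁ / (M.root θ * (1 / M.root θ - 1)) * P * Q) =
    M.lam₁ * (1 / M.root θ) * P * Q by
      intro P Q
      generalize (1 / M.root θ - 1 : ℂ) = d at hyi
      field_simp]
  rw [Complex.ofReal_tsum] at hfe
  push_cast at hfe
  have hyy : (1 / M.root θ : ℂ) * M.root θ = 1 := by field_simp
  linear_combination -hfe + (M.lam₁ * w * ∑' k, (p (0, k) : ℂ) * (M.root θ : ℂ) ^ k) * hyy

lemma Stable.summable_norm_genP₁ (h : M.Stable) {p : State → ℝ}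
    (hp : IsStationaryDistribution M.rate p) :
    Summable fun k : ℕ => ‖((p (k, 0) * M.r₁ ^ k : ℝ) : ℂ)‖ := by
  refine ((h.summable_r₁ hp).comp_injective (i := fun k : ℕ => ((k, 0) : State))
    fun a b hab => by simpa using hab).congr fun k => ?_
  rw [Complex.norm_real, Real.norm_of_nonneg
    (mul_nonneg (hp.nonneg _) (pow_nonneg h.r₁_pos.le _))]
  simp

lemma genP₁_r₁_mul (p : State → ℝ) (z : ℂ) :
    genP₁ p (M.r₁ * z) = ∑' k : ℕ, ((p (k, 0) * M.r₁ ^ k : ℝ) : ℂ) * z ^ k := by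
  rw [genP₁]
  refine tsum_congr fun k => ?_
  push_cast
  ring

/-! ### Solution of the Riemann-Hilbert problem -/

/-- The quotient of `P₁` by the homogeneous solution, on the unit disc. -/
noncomputable def quotientFun (M : Model) (p : State → ℝ) (z : ℂ) : ℂ :=
  genP₁ p (M.r₁ * z) * Complex.exp (-sineSeries M.angle z)

lemma Stable.diffContOnCl_quotientFun (h : M.Stable) {p : State → ℝ}
    (hp : IsStationaryDistribution M.rate p) :
    DiffContOnCl ℂ (M.quotientFun p) (Metric.ball 0 1) := by
  have h1 := diffContOnCl_tsum_mul_pow (h.summable_norm_genP₁ hp)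
  have h2 := diffContOnCl_tsum_mul_pow
    (summable_norm_sineCoeff h.contDiff_angle angle_zero angle_pi)
  have h3 := (Complex.differentiable_exp.comp_diffContOnCl h2.neg)
  have e : M.quotientFun p = fun z => (∑' k : ℕ, ((p (k, 0) * M.r₁ ^ k : ℝ) : ℂ) * z ^ k) •
      Complex.exp (-∑' k : ℕ, (sineCoeff M.angle k : ℂ) * z ^ k) := by
    funext z
    rw [quotientFun, genP₁_r₁_mul, sineSeries, smul_eq_mul]
  rw [e]
  exact h1.smul h3

lemma quotientFun_conj (p : State → ℝ) (z : ℂ) :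
    M.quotientFun p (conj z) = conj (M.quotientFun p z) := by
  simp only [quotientFun, genP₁_r₁_mul, sineSeries]
  rw [conj_tsum_ofReal_mul_pow, conj_tsum_ofReal_mul_pow, map_mul, ← Complex.exp_conj, map_neg]

lemma Stable.quotientFun_im (h : M.Stable) {p : State → ℝ}
    (hp : IsStationaryDistribution M.rate p) {θ : ℝ} (hθ : θ ∈ Ioo 0 Real.pi) :
    (M.quotientFun p (Complex.exp (θ * Complex.I))).im =
      M.lam₁ / M.lam₂ * (polyP₂minus M.a p (M.root θ) * (Real.sin (M.Theta₁ (M.root θ)) *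
        Real.exp (-M.Phi₁ (M.root Real.pi) (M.root 0) (M.root θ)))) := by
  obtain ⟨R, hR⟩ := h.boundary_equation hp θ
  have hl : (M.lam₂ : ℂ) ≠ 0 := by exact_mod_cast h.lam₂_pos.ne'
  rw [h.Theta₁_root (Ioo_subset_Icc_self hθ)]
  set Q := polyP₂minus M.a p (M.root θ)
  set φ := M.Phi₁ (M.root Real.pi) (M.root 0) (M.root θ) with hφ
  -- Dividing by `exp S = exp(φ + i angle)` makes the unknown multiple `R` real, so it drops out of
  -- the imaginary part.
  have e : M.quotientFun p (Complex.exp (θ * Complex.I)) = ((Real.exp (-φ) / M.lam₂ : ℝ) : ℂ) *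
      (R - M.lam₁ * Q * Complex.exp (-(M.angle θ * Complex.I))) := by
    rw [quotientFun, h.sineSeries_angle_exp hθ, ← hφ, neg_add, Complex.exp_add, ← Complex.ofReal_neg,
      ← Complex.ofReal_exp]
    have h1 := exp_mul_I_mul_exp_neg_mul_I (M.angle θ)
    generalize Complex.exp (M.angle θ * Complex.I) = u at *
    generalize Complex.exp (-(M.angle θ * Complex.I)) = v at *
    rw [Complex.ofReal_div]
    generalize ((Real.exp (-φ) : ℝ) : ℂ) = t
    field_simp
    linear_combination t * v * hR + t * R * h1
  rw [e, Complex.im_ofReal_mul, ← neg_mul, ← Complex.ofReal_neg, ← Complex.ofReal_mul,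
    Complex.sub_im, Complex.ofReal_im, Complex.im_ofReal_mul, Complex.exp_ofReal_mul_I_im,
    Real.sin_neg]
  field_simp
  ring

lemma Stable.phi₁_eq (h : M.Stable) {z : ℂ} (hz : ‖z‖ < 1) :
    IntervalIntegrable (M.phi₁Integrand (M.r₁ * z)) volume (M.root Real.pi) (M.root 0) ∧
    M.phi₁ (M.root Real.pi) (M.root 0) (M.r₁ * z) = Complex.exp (sineSeries M.angle z) := by
  obtain ⟨h1, h2⟩ := h.integral_density hz (G := M.angle) (q := fun θ => M.Theta₁ (M.root θ))
    (f := M.phi₁Integrand (M.r₁ * z)) h.contDiff_angle.continuous.continuousOn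
    (fun θ hθ => h.Theta₁_root (Ioo_subset_Icc_self hθ)) (fun θ _ => rfl)
  refine ⟨h1, ?_⟩
  rw [phi₁, sineSeries_eq_integral h.contDiff_angle.continuous hz, ← h2]
  congr 1
  ring

lemma Stable.P₁Integrand_eq (h : M.Stable) {p : State → ℝ}
    (hp : IsStationaryDistribution M.rate p) {z : ℂ} (hz : ‖z‖ < 1) :
    IntervalIntegrable (M.P₁Integrand p (M.root Real.pi) (M.root 0) (M.r₁ * z)) volume
      (M.root Real.pi) (M.root 0) ∧
    M.lam₁ * ((M.r₁ * z : ℂ) * ∫ y in (M.root Real.pi)..(M.root 0),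
      M.P₁Integrand p (M.root Real.pi) (M.root 0) (M.r₁ * z) y) =
    M.lam₂ * ∫ θ in (0 : ℝ)..Real.pi,
      ((M.quotientFun p (Complex.exp (θ * Complex.I))).im : ℂ) * schwarzKernel z θ := by
  have hl1 := h.lam₁_pos.ne'
  have hl2 := h.lam₂_pos.ne'
  have hcont : Continuous fun θ : ℝ => M.quotientFun p (Complex.exp (θ * Complex.I)) := by
    have := (h.diffContOnCl_quotientFun hp).continuousOn
    rw [closure_ball _ one_ne_zero] at this
    refine this.comp_continuous (by fun_prop) fun θ => ?_
    simp [Complex.norm_exp_ofReal_mul_I]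
  obtain ⟨h1, h2⟩ := h.integral_density hz
    -- The boundary values of the quotient are continuous on the whole circle, so integrability
    -- needs no estimate of `Φ₁` near the branch points.
    (G := fun θ => M.lam₂ / M.lam₁ * (M.quotientFun p (Complex.exp (θ * Complex.I))).im)
    (q := fun θ => polyP₂minus M.a p (M.root θ) * (Real.sin (M.Theta₁ (M.root θ)) *
        Real.exp (-M.Phi₁ (M.root Real.pi) (M.root 0) (M.root θ))))
    (f := M.P₁Integrand p (M.root Real.pi) (M.root 0) (M.r₁ * z))
    (continuous_const.mul (Complex.continuous_im.comp hcont)).continuousOn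
    (fun θ hθ => by
      simp only [h.quotientFun_im hp hθ]
      field_simp)
    (fun θ _ => by
      rw [P₁Integrand, div_mul_eq_mul_div, ← Complex.ofReal_mul, mul_assoc])
  refine ⟨h1, ?_⟩
  rw [h2, ← intervalIntegral.integral_const_mul, ← intervalIntegral.integral_const_mul]
  refine intervalIntegral.integral_congr fun θ _ => ?_
  have hl1' : (M.lam₁ : ℂ) ≠ 0 := by exact_mod_cast hl1
  push_cast
  field_simp

end Model

lemma genP₁_zero (p : State → ℝ) : genP₁ p 0 = p (0, 0) := by
  rw [genP₁, tsum_eq_single 0 fun n hn => by simp [hn]]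
  simp

lemma genP_zero_zero (p : State → ℝ) : genP p 0 0 = p (0, 0) := by
  rw [genP, tsum_eq_single (0, 0)]
  · simp
  · rintro ⟨n₁, n₂⟩ hn
    rcases eq_or_ne n₁ 0 with rfl | h1
    · have h2 : n₂ ≠ 0 := by rintro rfl; exact hn rfl
      simp [h2]
    · simp [h1]

end TrunkReservation

theorem mainTheorem2 (M : Model)
    (hlam₁ : 0 < M.lam₁) (hlam₂ : 0 < M.lam₂) (hmu₁ : 0 < M.mu₁) (hmu₂ : 0 < M.mu₂)
    (hc₁ : 0 < M.c₁) (hc₂ : 0 < M.c₂)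
    (hstab₁ : M.mu₁ * M.c₁ < M.lam₁)
    (hstab₂ : M.mu₁ * M.c₁ + M.mu₂ * M.c₂ < M.lam₁ + M.lam₂)
    (p : State → ℝ) (hp : IsStationaryDistribution M.rate p) :
    ∃ y₁ y₂ y₃ y₄ : ℝ,
      0 < y₁ ∧ y₁ < y₂ ∧ y₂ < 1 ∧ 1 < y₃ ∧ y₃ < y₄ ∧
      (∀ y : ℝ, M.Delta₁ y = 0 ↔ y = y₁ ∨ y = y₂ ∨ y = y₃ ∨ y = y₄) ∧
      (∀ y ∈ Set.Ioo y₁ y₂,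
        HasCauchyPV (M.Phi₁Integrand y) y₁ y₂ y (Real.pi * M.Phi₁ y₁ y₂ y)) ∧
      ∀ x : ℂ, ‖x‖ < M.r₁ →
        Summable (fun n : ℕ => (p (n, 0) : ℂ) * x ^ n) ∧
        IntervalIntegrable (M.phi₁Integrand x) MeasureTheory.volume y₁ y₂ ∧
        IntervalIntegrable (M.P₁Integrand p y₁ y₂ x) MeasureTheory.volume y₁ y₂ ∧
        genP₁ p x =
          M.phi₁ y₁ y₂ x * genP p 0 0
            + x * (M.lam₁ : ℂ) * M.phi₁ y₁ y₂ x / ((M.lam₂ : ℂ) * (Real.pi : ℂ))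
              * ∫ y in y₁..y₂, M.P₁Integrand p y₁ y₂ x y := by
  have h : M.Stable := ⟨hlam₁, hlam₂, mul_pos hmu₁ hc₁, mul_pos hmu₂ hc₂, hstab₁⟩
  refine ⟨M.root Real.pi, M.root 0, M.coRoot 0, M.coRoot Real.pi, h.root_pos _,
    h.root_pi_lt_root_zero, (h.root_lt_one_lt_coRoot 0).1, (h.root_lt_one_lt_coRoot 0).2,
    h.coRoot_zero_lt_coRoot_pi, h.Delta₁_eq_zero_iff, ?_, ?_⟩
  · intro y hy
    rw [← h.image_root] at hy
    obtain ⟨θ, hθ, rfl⟩ := hy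
    rw [h.pi_mul_Phi₁ hθ]
    exact h.hasCauchyPV hθ
  · intro x hx
    have hr := h.r₁_pos
    have hr' : (M.r₁ : ℂ) ≠ 0 := by exact_mod_cast hr.ne'
    obtain ⟨z, rfl⟩ : ∃ z : ℂ, x = M.r₁ * z := ⟨x / M.r₁, by field_simp⟩
    rw [norm_mul, Complex.norm_real, Real.norm_of_nonneg hr.le, mul_lt_iff_lt_one_right hr] at hx
    obtain ⟨h1, h2⟩ := h.phi₁_eq hx
    obtain ⟨h3, h4⟩ := h.P₁Integrand_eq hp hx
    refine ⟨?_, h1, h3, ?_⟩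
    · refine Summable.of_norm_bounded (h.summable_norm_genP₁ hp) fun k => ?_
      rw [mul_pow, ← mul_assoc, ← Complex.ofReal_pow, ← Complex.ofReal_mul, norm_mul, norm_pow]
      exact mul_le_of_le_one_right (norm_nonneg _) (pow_le_one₀ (norm_nonneg _) hx.le)
    · have hS := eq_add_integral_im_mul_schwarzKernel (h.diffContOnCl_quotientFun hp)
        (fun z _ => Model.quotientFun_conj p z) hx
      have hF0 : M.quotientFun p 0 = genP p 0 0 := by
        rw [Model.quotientFun, mul_zero, genP₁_zero, sineSeries_zero, neg_zero, Complex.exp_zero,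
          mul_one, genP_zero_zero]
      have hFz : genP₁ p (M.r₁ * z) =
          Complex.exp (sineSeries M.angle z) * M.quotientFun p z := by
        rw [Model.quotientFun, mul_left_comm, ← Complex.exp_add, add_neg_cancel, Complex.exp_zero,
          mul_one]
      rw [hFz, h2, hS, hF0]
      have hl2 : (M.lam₂ : ℂ) ≠ 0 := by exact_mod_cast hlam₂.ne'
      have hpi : (Real.pi : ℂ) ≠ 0 := by exact_mod_cast Real.pi_ne_zero
      generalize (∫ θ in (0 : ℝ)..Real.pi, ((M.quotientFun p
        (Complex.exp (θ * Complex.I))).im : ℂ) * schwarzKernel z θ) = J at *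
      field_simp
      linear_combination (-1 : ℂ) * h4
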